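/- All graphs are finite and loopless; multiple edges are allowed. A graph is $m$-tree-connected ($m\ge 1$ an integer) if it has $m$ pairwise edge-disjoint spanning trees; the graph with no vertices is not $m$-tree-connected. The vertex set of every graph $G$ is uniquely partitioned into the maximal sets of vertices that induce $m$-tree-connected subgraphs; with $P$ this partition and $e_G(P)$ the number of edges of $G$ whose ends lie in different parts of $P$, let $\Omega_m(G)=|P|-\frac1m e_G(P)$ (so $\Omega_m=0$ for the graph with no vertices). Write $d_G(v)$ for the degree of $v$ in $G$, $e_G(S)$ for the number of edges of $G$ with both ends in $S$, and $G\setminus S$ for the graph obtained from $G$ by removing the vertices of $S$. **Theorem.** Let $m\ge 1$ be an integer, let $G$ be an $m$-tree-connected graph, let $X\subseteq V(G)$, and let $F$ be a spanning subgraph of $G$. Let $\lambda\in[0,1/m]$ be a real number and let $\eta:X\to\left(m\lambda+\frac{m-1}{m},\infty\right)$ be a real function. If for all $S\subseteq X$ $$\Omega_m(G\setminus S)<\frac1m+\sum_{v\in S}\bigl(\eta(v)-2\bigr)+2-\lambda\bigl(e_G(S)+m\bigr),$$ then $G$ has an $m$-tree-connected spanning subgraph $H$ containing $F$ such that for each $v\in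 X$ $$d_H(v)\le\bigl\lceil m\eta(v)-m^2\lambda\bigr\rceil+\max\{0,d_F(v)-m\}.$$ -/

import Mathlib

open scoped Graph

namespace Graph

/-- A (multi)graph is connected if it has a vertex and any two of its vertices are joined by a
walk. -/
def IsConnected {α β : Type*} (G : Graph α β) : Prop :=
  V(G).Nonempty ∧ ∀ x ∈ V(G), ∀ y ∈ V(G), Relation.ReflTransGen G.Adj x y

/-- A (multi)graph has a cycle if, for some `n`, there are `n + 1` distinct vertices and `n + 1`
distinct edges such that the `i`-th edge joins the `i`-th vertex to the cyclically next one (the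
addition in `Fin (n + 1)` is cyclic). The case `n = 0` is a loop, the case `n = 1` a pair of
parallel edges. -/
def HasCycle {α β : Type*} (G : Graph α β) : Prop :=
  ∃ (n : ℕ) (v : Fin (n + 1) → α) (e : Fin (n + 1) → β),
    Function.Injective v ∧ Function.Injective e ∧ ∀ i, G.IsLink (e i) (v i) (v (i + 1))

/-- A tree is a connected graph without cycles. -/
def IsTree {α β : Type*} (G : Graph α β) : Prop :=
  G.IsConnected ∧ ¬ G.HasCycle

/-- `G` is `m`-tree-connected (`m ≥ 1`): it has `m` pairwise edge-disjoint spanning trees. -/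
def IsTreeConnected {α β : Type*} (m : ℕ) (G : Graph α β) : Prop :=
  ∃ T : Fin m → Graph α β,
    (∀ i, T i ≤s G ∧ (T i).IsTree) ∧ ∀ i j, i ≠ j → Disjoint E(T i) E(T j)

/-- The vertex sets of the `m`-tree-connected components of `G`: the inclusion-maximal sets of
vertices that induce an `m`-tree-connected subgraph. -/
def treeComponents {α β : Type*} (m : ℕ) (G : Graph α β) : Set (Set α) :=
  {A | Maximal (fun B : Set α => B ⊆ V(G) ∧ (G.induce B).IsTreeConnected m) A}

/-- The edges of `G` whose ends lie in different members of the family `P` of vertex sets. -/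
def crossingEdges {α β : Type*} (G : Graph α β) (P : Set (Set α)) : Set β :=
  {e | ∃ x y, G.IsLink e x y ∧ ∃ A ∈ P, ∃ B ∈ P, A ≠ B ∧ x ∈ A ∧ y ∈ B}

/-- The tree-connectivity measure `Ω_m(G) = |P| - e_G(P) / m`, where `P` is the partition of the
vertex set into the `m`-tree-connected components (for finite graphs and `m ≥ 1`). -/
noncomputable def treeMeasure {α β : Type*} (m : ℕ) (G : Graph α β) : ℝ :=
  ((treeComponents m G).ncard : ℝ) - 1 / (m : ℝ) * ((G.crossingEdges (treeComponents m G)).ncard : ℝ)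

/-- The degree of a vertex: the number of edges incident with it (for finite loopless graphs). -/
noncomputable def deg {α β : Type*} (G : Graph α β) (v : α) : ℕ :=
  (G.incidenceSet v).ncard

/-- `e_G(S)`: the number of edges of `G` with both ends in `S` (for finite graphs). -/
noncomputable def numEdgesInside {α β : Type*} (G : Graph α β) (S : Set α) : ℕ :=
  {e | ∃ x ∈ S, ∃ y ∈ S, G.IsLink e x y}.ncard

end Graph

/-!
Call an edge set sparse if every nonempty vertex set `A` spans at most `m (|A| - 1)` of its edges.
The sparse sets are the independent sets of a matroid, and by Nash-Williams' theorem, proved by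
moving an uncoloured edge around until some colour fits, they are the unions of `m` edge-disjoint
forests. Hence a graph is `m`-tree-connected iff it has a sparse edge set for which the whole vertex
set `V` is tight, and `m Ω_m(G) = m |V| - r` with `r` the size of a maximal sparse edge set of `G`.

Let `F₀` be a maximal sparse subset of `F`. Among the maximal sparse sets `T ⊇ F₀` of `G` choose one
whose degrees exceed `⌈m η(v) - m² λ⌉ + max {0, d_{F₀}(v) - m}` by the least total amount.
If some bound is violated, let `S` grow from the overloaded vertices: add every vertex whose degree
cannot be brought below its bound by exchanging edges that avoid the current `S`. By minimality of
the excess, the edges of `T` that avoid `S`, together with those of `F₀`, span all edges of `G` that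
avoid `S`. Counting the edges of `T` then gives a lower bound on `Ω_m(G \ S)` that contradicts the
hypothesis for `S`.

Otherwise `H = T ∪ F` works: the ends of an edge of `F \ F₀` lie in a tight set of `F₀`, so
`d_{F₀}(v) ≥ m` at both of them, and adding these edges costs no more than `d_F(v) - d_{F₀}(v)`.
-/

namespace EdgeSparsity

open Finset

section Sparse

variable {α β : Type*} [DecidableEq α] {ends : β → Finset α} {m k : ℕ}
  {D E F I J K N : Finset β} {A B V Z : Finset α} {Q : Finset (Finset α)} {e f : β} {v : α}

/-- The edges of `I` all of whose ends lie in `A`; here and below an edge is only known through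
the set `ends e` of its ends, so that everything applies to hypergraphs. -/
def inside (ends : β → Finset α) (I : Finset β) (A : Finset α) : Finset β :=
  {e ∈ I | ends e ⊆ A}

/-- `I` is `m`-sparse: every nonempty vertex set `A` spans at most `m (|A| - 1)` edges of `I`.
These are the independent sets of a matroid, for graphs the union of `m` graphic matroids. -/
def Sparse (ends : β → Finset α) (m : ℕ) (I : Finset β) : Prop :=
  ∀ ⦃A : Finset α⦄, A.Nonempty → #(inside ends I A) + m ≤ m * #A

/-- `A` is tight for `I`: it is nonempty and spans exactly `m (|A| - 1)` edges of `I`. -/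
def Tight (ends : β → Finset α) (m : ℕ) (I : Finset β) (A : Finset α) : Prop :=
  A.Nonempty ∧ #(inside ends I A) + m = m * #A

/-- `B` lies in a tight set. For the ends of an edge `e ∉ I` this says that `e` depends on `I`. -/
def Rigid (ends : β → Finset α) (m : ℕ) (I : Finset β) (B : Finset α) : Prop :=
  ∃ A, Tight ends m I A ∧ B ⊆ A

/-- `I` spans `K` in the matroid of `m`-sparse sets. -/
def Spans (ends : β → Finset α) (m : ℕ) (I K : Finset β) : Prop :=
  ∀ e ∈ K, e ∈ I ∨ Rigid ends m I (ends e)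

lemma mem_inside : e ∈ inside ends I A ↔ e ∈ I ∧ ends e ⊆ A := mem_filter

lemma inside_subset : inside ends I A ⊆ I := filter_subset _ _

lemma inside_mono (hIJ : I ⊆ J) (hAB : A ⊆ B) : inside ends I A ⊆ inside ends J B := by
  intro e he
  rw [mem_inside] at he ⊢
  exact ⟨hIJ he.1, he.2.trans hAB⟩

lemma inside_inside : inside ends (inside ends I A) B = inside ends I (A ∩ B) := by
  ext e
  simp only [mem_inside, subset_inter_iff, and_assoc]

lemma inside_eq_self (h : ∀ e ∈ I, ends e ⊆ A) : inside ends I A = I :=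
  filter_true_of_mem h

lemma inside_insert_of_subset [DecidableEq β] (h : ends e ⊆ A) :
    inside ends (insert e I) A = insert e (inside ends I A) := by
  rw [inside, filter_insert, if_pos h, inside]

lemma inside_insert_of_not_subset [DecidableEq β] (h : ¬ ends e ⊆ A) :
    inside ends (insert e I) A = inside ends I A := by
  rw [inside, filter_insert, if_neg h, inside]

lemma card_inside_add_card_inside_le (I : Finset β) (A B : Finset α) :
    #(inside ends I A) + #(inside ends I B) ≤
      #(inside ends I (A ∪ B)) + #(inside ends I (A ∩ B)) := by
  classical
  rw [← card_union_add_card_inter]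
  refine add_le_add (card_le_card ?_) (card_le_card fun e he => ?_)
  · exact union_subset (inside_mono subset_rfl subset_union_left)
      (inside_mono subset_rfl subset_union_right)
  · simp only [mem_inter, mem_inside, subset_inter_iff] at he ⊢
    tauto

lemma Sparse.mono (hJ : Sparse ends m J) (hIJ : I ⊆ J) : Sparse ends m I := fun _ hA =>
  (Nat.add_le_add_right (card_le_card (inside_mono hIJ subset_rfl)) m).trans (hJ hA)

lemma sparse_empty (ends : β → Finset α) (m : ℕ) : Sparse ends m ∅ := fun A hA => by
  simpa [inside] using Nat.le_mul_of_pos_right m hA.card_pos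

lemma Sparse.one_lt_card_ends [Nonempty α] (hI : Sparse ends m I) (he : e ∈ I) :
    1 < #(ends e) := by
  by_contra! hle
  obtain ⟨x, hx⟩ := card_le_one_iff_subset_singleton.1 hle
  have hpos : 0 < #(inside ends I {x}) := card_pos.2 ⟨e, mem_inside.2 ⟨he, hx⟩⟩
  have hsparse := hI (singleton_nonempty x)
  rw [card_singleton] at hsparse
  lia

lemma Sparse.ends_nonempty [Nonempty α] (hI : Sparse ends m I) (he : e ∈ I) :
    (ends e).Nonempty :=
  card_pos.1 (pos_of_gt (hI.one_lt_card_ends he))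

lemma Sparse.tight_singleton (hI : Sparse ends m I) (x : α) : Tight ends m I {x} := by
  have hsparse := hI (singleton_nonempty x)
  refine ⟨singleton_nonempty x, ?_⟩
  rw [card_singleton] at hsparse ⊢
  lia

lemma Tight.mono (hA : Tight ends m I A) (hJ : Sparse ends m J) (hIJ : I ⊆ J) :
    Tight ends m J A := by
  refine ⟨hA.1, (hJ hA.1).antisymm ?_⟩
  rw [← hA.2]
  exact Nat.add_le_add_right (card_le_card (inside_mono hIJ subset_rfl)) m

lemma Tight.inside_eq (hA : Tight ends m I A) (hJ : Sparse ends m J) (hIJ : I ⊆ J) :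
    inside ends I A = inside ends J A := by
  refine eq_of_subset_of_card_le (inside_mono hIJ subset_rfl) ?_
  have hcardI := hA.2
  have hcardJ := (hA.mono hJ hIJ).2
  lia

lemma Tight.union_and_inter (hI : Sparse ends m I) (hA : Tight ends m I A) (hB : Tight ends m I B)
    (hAB : (A ∩ B).Nonempty) : Tight ends m I (A ∪ B) ∧ Tight ends m I (A ∩ B) := by
  have hne : (A ∪ B).Nonempty := hA.1.mono subset_union_left
  have hunion := hI hne
  have hinter := hI hAB
  have hsuper := card_inside_add_card_inside_le (ends := ends) I A B
  have hcard : m * #(A ∪ B) + m * #(A ∩ B) = m * #A + m * #B := by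
    rw [← mul_add, ← mul_add, card_union_add_card_inter]
  have hcardA := hA.2
  have hcardB := hB.2
  exact ⟨⟨hne, by lia⟩, ⟨hAB, by lia⟩⟩

lemma Tight.union (hI : Sparse ends m I) (hA : Tight ends m I A) (hB : Tight ends m I B)
    (hAB : (A ∩ B).Nonempty) : Tight ends m I (A ∪ B) :=
  (hA.union_and_inter hI hB hAB).1

lemma Tight.inter (hI : Sparse ends m I) (hA : Tight ends m I A) (hB : Tight ends m I B)
    (hAB : (A ∩ B).Nonempty) : Tight ends m I (A ∩ B) :=
  (hA.union_and_inter hI hB hAB).2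

lemma Tight.inter_of_ends_subset (hI : Sparse ends m I) (hA : Tight ends m I A)
    (hV : ∀ e ∈ I, ends e ⊆ V) (hAV : (A ∩ V).Nonempty) : Tight ends m I (A ∩ V) := by
  have hinside : inside ends I (A ∩ V) = inside ends I A := by
    rw [inter_comm, ← inside_inside, inside_eq_self hV]
  refine ⟨hAV, (hI hAV).antisymm ?_⟩
  rw [hinside, hA.2]
  exact Nat.mul_le_mul_left m (card_le_card inter_subset_left)

lemma Rigid.exists_isLeast (hI : Sparse ends m I) (hB : B.Nonempty) (h : Rigid ends m I B) :
    ∃ Z, IsLeast {A | Tight ends m I A ∧ B ⊆ A} Z := by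
  obtain ⟨Z, hZ⟩ := exists_minimal_of_wellFoundedLT (fun A => Tight ends m I A ∧ B ⊆ A) h
  refine ⟨Z, hZ.prop, fun A hA => ?_⟩
  have hBZA : B ⊆ Z ∩ A := subset_inter hZ.prop.2 hA.2
  have hZA : Tight ends m I (Z ∩ A) := hZ.prop.1.inter hI hA.1 (hB.mono hBZA)
  exact (hZ.le_of_le ⟨hZA, hBZA⟩ inter_subset_left).trans inter_subset_right

lemma Tight.disjoint_of_not_rigid {x y : α} (hI : Sparse ends m I)
    (hA : Tight ends m I A) (hB : Tight ends m I B) (hx : x ∈ A) (hy : y ∈ B)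
    (hnot : ¬ Rigid ends m I {x, y}) : Disjoint A B := by
  by_contra hmeet
  exact hnot ⟨A ∪ B, hA.union hI hB (not_disjoint_iff_nonempty_inter.1 hmeet),
    insert_subset (mem_union_left _ hx) (singleton_subset_iff.2 (mem_union_right _ hy))⟩

lemma Rigid.exists_tight_superset {x y : α} (hI : Sparse ends m I)
    (hA : Tight ends m I A) (hB : Tight ends m I B) (hx : x ∈ A) (hy : y ∈ B)
    (hrigid : Rigid ends m I {x, y}) : ∃ C, Tight ends m I C ∧ A ⊆ C ∧ B ⊆ C := by
  obtain ⟨D, hD, hxyD⟩ := hrigid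
  obtain ⟨hxD, hyD⟩ := insert_subset_iff.1 hxyD
  have hDA : Tight ends m I (D ∪ A) := hD.union hI hA ⟨x, mem_inter.2 ⟨hxD, hx⟩⟩
  exact ⟨D ∪ A ∪ B, hDA.union hI hB
    ⟨y, mem_inter.2 ⟨mem_union_left _ (singleton_subset_iff.1 hyD), hy⟩⟩,
    subset_union_right.trans subset_union_left, subset_union_right⟩

section Exchange

variable [DecidableEq β]

lemma Sparse.rigid_of_not_sparse_insert (hI : Sparse ends m I)
    (he : ¬ Sparse ends m (insert e I)) : Rigid ends m I (ends e) := by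
  unfold Sparse at he
  push Not at he
  obtain ⟨A, hA, hlt⟩ := he
  have hle := hI hA
  by_cases heA : ends e ⊆ A
  · rw [inside_insert_of_subset heA] at hlt
    have hins := card_insert_le e (inside ends I A)
    exact ⟨A, ⟨hA, by lia⟩, heA⟩
  · rw [inside_insert_of_not_subset heA] at hlt
    lia

lemma Sparse.insert_erase (hI : Sparse ends m I)
    (hZ : IsLeast {A | Tight ends m I A ∧ ends e ⊆ A} Z) (hf : f ∈ inside ends I Z) :
    Sparse ends m (insert e (I.erase f)) := by
  intro A hA
  by_cases heA : ends e ⊆ A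
  · rw [inside_insert_of_subset heA]
    have hins := card_insert_le e (inside ends (I.erase f) A)
    have hle := hI hA
    by_cases hAtight : #(inside ends I A) + m = m * #A
    · have hfA : f ∈ inside ends I A :=
        inside_mono subset_rfl (hZ.2 ⟨⟨hA, hAtight⟩, heA⟩) hf
      have herase : #(inside ends (I.erase f) A) + 1 = #(inside ends I A) := by
        rw [inside, filter_erase, ← inside, card_erase_add_one hfA]
      lia
    · have hsub := card_le_card (inside_mono (ends := ends) (erase_subset f I) (subset_refl A))
      lia
  · rw [inside_insert_of_not_subset heA]
    exact hI.mono (erase_subset f I) hA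

lemma Sparse.union_star [Nonempty α] (hI : Sparse ends m I) (hv : ∀ e ∈ I, v ∉ ends e)
    (hN : ∀ e ∈ N, v ∈ ends e ∧ 1 < #(ends e)) (hNm : #N ≤ m) : Sparse ends m (I ∪ N) := by
  intro A hA
  by_cases hvA : v ∈ A
  · have hsub : inside ends (I ∪ N) A ⊆ inside ends I (A.erase v) ∪ inside ends N A := by
      intro e he
      rw [mem_inside, mem_union] at he
      rw [mem_union, mem_inside, mem_inside]
      exact he.1.imp (fun heI => ⟨heI, subset_erase.2 ⟨he.2, hv e heI⟩⟩) fun heN => ⟨heN, he.2⟩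
    have hcard := (card_le_card hsub).trans (card_union_le _ _)
    rcases (A.erase v).eq_empty_or_nonempty with hempty | hne
    · have hA1 : #A = 1 := by rw [← card_erase_add_one hvA, hempty, card_empty]
      have hI0 : inside ends I (A.erase v) = ∅ := by
        refine filter_false_of_mem fun e he hsub => ?_
        rw [hempty, subset_empty] at hsub
        exact (hI.ends_nonempty he).ne_empty hsub
      have hN0 : inside ends N A = ∅ := filter_false_of_mem fun e he hsub =>
        ((hN e he).2.trans_le (card_le_card hsub)).ne' hA1
      rw [hI0, hN0, card_empty] at hcard
      rw [hA1]
      lia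
    · have hle := hI hne
      have hNA : #(inside ends N A) ≤ m := (card_le_card inside_subset).trans hNm
      have hcardA : m * #A = m * #(A.erase v) + m := by
        rw [← card_erase_add_one hvA, mul_add, mul_one]
      lia
  · have hsub : inside ends (I ∪ N) A ⊆ inside ends I A := by
      intro e he
      rw [mem_inside, mem_union] at he
      exact mem_inside.2 ⟨he.1.resolve_right fun heN => hvA (he.2 (hN e heN).1), he.2⟩
    exact (Nat.add_le_add_right (card_le_card hsub) m).trans (hI hA)

end Exchange

lemma Sparse.exists_spans (hF : Sparse ends m F) (hFE : F ⊆ E) :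
    ∃ I, F ⊆ I ∧ I ⊆ E ∧ Sparse ends m I ∧ Spans ends m I E := by
  classical
  obtain ⟨I, hFI, hI⟩ := exists_le_maximal {I ∈ E.powerset | Sparse ends m I}
    (mem_filter.2 ⟨mem_powerset.2 hFE, hF⟩)
  obtain ⟨hIE, hIsparse⟩ := mem_filter.1 hI.prop
  rw [mem_powerset] at hIE
  refine ⟨I, hFI, hIE, hIsparse, fun e he => or_iff_not_imp_left.2 fun heI => ?_⟩
  refine hIsparse.rigid_of_not_sparse_insert fun hins => heI ?_
  have hmem : insert e I ∈ ({I ∈ E.powerset | Sparse ends m I} : Finset (Finset β)) :=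
    mem_filter.2 ⟨mem_powerset.2 (insert_subset he hIE), hins⟩
  exact hI.le_of_ge hmem (subset_insert e I) (mem_insert_self e I)

open Classical in
/-- The inclusion-maximal tight subsets of `V`. They partition `V` when `I` is sparse. -/
noncomputable def tightParts (ends : β → Finset α) (m : ℕ) (I : Finset β) (V : Finset α) :
    Finset (Finset α) :=
  {A ∈ V.powerset | Maximal (fun B => B ⊆ V ∧ Tight ends m I B) A}

lemma mem_tightParts :
    A ∈ tightParts ends m I V ↔ Maximal (fun B => B ⊆ V ∧ Tight ends m I B) A := by
  classical
  rw [tightParts, mem_filter, mem_powerset, and_iff_right_of_imp fun h => h.prop.1]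

lemma Tight.exists_mem_tightParts (hB : Tight ends m I B) (hBV : B ⊆ V) :
    ∃ A ∈ tightParts ends m I V, B ⊆ A := by
  classical
  obtain ⟨A, hBA, hA⟩ := exists_le_maximal {B ∈ V.powerset | Tight ends m I B}
    (mem_filter.2 ⟨mem_powerset.2 hBV, hB⟩)
  exact ⟨A, mem_tightParts.2 (by simpa only [mem_filter, mem_powerset] using hA), hBA⟩

lemma Rigid.exists_mem_tightParts (hI : Sparse ends m I) (hV : ∀ e ∈ I, ends e ⊆ V)
    (hB : B.Nonempty) (hBV : B ⊆ V) (h : Rigid ends m I B) :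
    ∃ A ∈ tightParts ends m I V, B ⊆ A := by
  obtain ⟨A, hA, hBA⟩ := h
  have hBAV : B ⊆ A ∩ V := subset_inter hBA hBV
  obtain ⟨C, hC, hAVC⟩ := (hA.inter_of_ends_subset hI hV (hB.mono hBAV)).exists_mem_tightParts
    inter_subset_right
  exact ⟨C, hC, hBAV.trans hAVC⟩

lemma Sparse.pairwiseDisjoint_tightParts (hI : Sparse ends m I) :
    (tightParts ends m I V : Set (Finset α)).PairwiseDisjoint id := by
  intro A hA B hB hAB
  rw [mem_coe, mem_tightParts] at hA hB
  by_contra hmeet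
  have hunion : A ∪ B ⊆ V ∧ Tight ends m I (A ∪ B) := ⟨union_subset hA.prop.1 hB.prop.1,
    hA.prop.2.union hI hB.prop.2 (not_disjoint_iff_nonempty_inter.1 hmeet)⟩
  exact hAB ((hA.eq_of_le hunion subset_union_left).trans
    (hB.eq_of_le hunion subset_union_right).symm)

lemma Sparse.biUnion_tightParts (hI : Sparse ends m I) :
    (tightParts ends m I V).biUnion id = V := by
  refine (biUnion_subset.2 fun A hA => (mem_tightParts.1 hA).prop.1).antisymm fun x hx => ?_
  obtain ⟨A, hA, hxA⟩ := (hI.tight_singleton x).exists_mem_tightParts (singleton_subset_iff.2 hx)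
  exact mem_biUnion.2 ⟨A, hA, hxA (mem_singleton_self x)⟩

/-- The edges of `K` not contained in any member of the family `Q` of vertex sets. -/
def crossing (ends : β → Finset α) (Q : Finset (Finset α)) (K : Finset β) : Finset β :=
  {e ∈ K | ∀ A ∈ Q, ¬ ends e ⊆ A}

lemma mem_crossing : e ∈ crossing ends Q K ↔ e ∈ K ∧ ∀ A ∈ Q, ¬ ends e ⊆ A := mem_filter

lemma card_eq_sum_inside_add_crossing (hQ : (Q : Set (Finset α)).PairwiseDisjoint id)
    (hK : ∀ e ∈ K, (ends e).Nonempty) :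
    #K = ∑ A ∈ Q, #(inside ends K A) + #(crossing ends Q K) := by
  classical
  have hunion : K.filter (fun e => ∃ A ∈ Q, ends e ⊆ A) = Q.biUnion (inside ends K) := by
    ext e
    simp only [mem_filter, mem_biUnion, mem_inside]
    tauto
  have hdisj : (Q : Set (Finset α)).PairwiseDisjoint (inside ends K) := by
    refine fun A hA B hB hAB => disjoint_left.2 fun e heA heB => ?_
    rw [mem_inside] at heA heB
    obtain ⟨x, hx⟩ := hK e heA.1
    exact disjoint_left.1 (hQ hA hB hAB) (heA.2 hx) (heB.2 hx)
  rw [← card_biUnion hdisj, ← hunion,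
    ← card_filter_add_card_filter_not (s := K) fun e => ∃ A ∈ Q, ends e ⊆ A, crossing]
  simp only [not_exists, not_and]

lemma Sparse.card_inside_eq_sum_add_crossing [Nonempty α] (hK : Sparse ends m K)
    (hQ : (Q : Set (Finset α)).PairwiseDisjoint id) (B : Finset α) :
    #(inside ends K B) =
      ∑ A ∈ Q, #(inside ends K (B ∩ A)) + #(crossing ends Q (inside ends K B)) := by
  have hends : ∀ e ∈ inside ends K B, (ends e).Nonempty := fun e he =>
    hK.ends_nonempty (inside_subset he)
  simpa only [inside_inside] using card_eq_sum_inside_add_crossing hQ hends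

lemma sum_card_inter_eq_card (hQ : (Q : Set (Finset α)).PairwiseDisjoint id)
    (hB : B ⊆ Q.biUnion id) : ∑ A ∈ Q, #(B ∩ A) = #B := by
  have hdisj : (Q : Set (Finset α)).PairwiseDisjoint fun A => B ∩ id A := fun A hA A' hA' hne =>
    (hQ hA hA' hne).mono inter_subset_right inter_subset_right
  calc ∑ A ∈ Q, #(B ∩ A) = #(Q.biUnion fun A => B ∩ id A) := (card_biUnion hdisj).symm
    _ = #B := by rw [← inter_biUnion, inter_eq_left.2 hB]

lemma Sparse.card_inside_add_le_crossing [Nonempty α] (hK : Sparse ends m K)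
    (hQ : (Q : Set (Finset α)).PairwiseDisjoint id) (hB : B ⊆ Q.biUnion id)
    (hmeet : ∀ A ∈ Q, (B ∩ A).Nonempty) :
    #(inside ends K B) + m * #Q ≤ m * #B + #(crossing ends Q (inside ends K B)) := by
  have hsum : ∑ A ∈ Q, (#(inside ends K (B ∩ A)) + m) ≤ ∑ A ∈ Q, m * #(B ∩ A) :=
    sum_le_sum fun A hA => hK (hmeet A hA)
  rw [sum_add_distrib, sum_const, smul_eq_mul, ← mul_sum, sum_card_inter_eq_card hQ hB] at hsum
  have hsplit := hK.card_inside_eq_sum_add_crossing hQ B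
  lia

lemma Sparse.card_inside_biUnion_eq_crossing [Nonempty α] (hK : Sparse ends m K)
    (hQ : (Q : Set (Finset α)).PairwiseDisjoint id) (htight : ∀ A ∈ Q, Tight ends m K A) :
    #(inside ends K (Q.biUnion id)) + m * #Q =
      m * #(Q.biUnion id) + #(crossing ends Q (inside ends K (Q.biUnion id))) := by
  have hinter : ∀ A ∈ Q, Q.biUnion id ∩ A = A := fun A hA =>
    inter_eq_right.2 (subset_biUnion_of_mem id hA)
  have hsum : ∑ A ∈ Q, (#(inside ends K (Q.biUnion id ∩ A)) + m) = ∑ A ∈ Q, m * #A :=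
    sum_congr rfl fun A hA => by rw [hinter A hA, (htight A hA).2]
  rw [sum_add_distrib, sum_const, smul_eq_mul, ← mul_sum] at hsum
  have hsplit := hK.card_inside_eq_sum_add_crossing hQ (Q.biUnion id)
  have hcard : #(Q.biUnion id) = ∑ A ∈ Q, #A := card_biUnion hQ
  lia

lemma Sparse.card_add_tightParts [Nonempty α] (hI : Sparse ends m I)
    (hV : ∀ e ∈ I, ends e ⊆ V) :
    #I + m * #(tightParts ends m I V) = m * #V + #(crossing ends (tightParts ends m I V) I) := by
  simpa only [hI.biUnion_tightParts, inside_eq_self hV] using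
    hI.card_inside_biUnion_eq_crossing (hI.pairwiseDisjoint_tightParts (V := V))
      fun A hA => (mem_tightParts.1 hA).prop.2

lemma Spans.crossing_tightParts_subset (hI : Sparse ends m I) (hV : ∀ e ∈ I, ends e ⊆ V)
    (hK : ∀ e ∈ K, (ends e).Nonempty ∧ ends e ⊆ V) (h : Spans ends m I K) :
    crossing ends (tightParts ends m I V) K ⊆ crossing ends (tightParts ends m I V) I := by
  intro e he
  rw [mem_crossing] at he ⊢
  refine ⟨(h e he.1).resolve_right fun hrigid => ?_, he.2⟩
  obtain ⟨A, hA, heA⟩ := hrigid.exists_mem_tightParts hI hV (hK e he.1).1 (hK e he.1).2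
  exact he.2 A hA heA

lemma Spans.card_le_mul [Nonempty α] (hm : 0 < m) (hD : Sparse ends k D)
    (hK : Sparse ends (m * k) K) (h : Spans ends k D K) : #K ≤ m * #D := by
  classical
  set V := (D ∪ K).biUnion ends
  have hDV : ∀ e ∈ D, ends e ⊆ V := fun e he =>
    subset_biUnion_of_mem ends (mem_union_left K he)
  have hKV : ∀ e ∈ K, ends e ⊆ V := fun e he =>
    subset_biUnion_of_mem ends (mem_union_right D he)
  set Q := tightParts ends k D V
  have hcardD : #D + k * #Q = k * #V + #(crossing ends Q D) := hD.card_add_tightParts hDV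
  have hcardK : #K + m * k * #Q ≤ m * k * #V + #(crossing ends Q K) := by
    have hQV : Q.biUnion id = V := hD.biUnion_tightParts
    have hmeet : ∀ A ∈ Q, (V ∩ A).Nonempty := fun A hA => by
      rw [inter_eq_right.2 (mem_tightParts.1 hA).prop.1]
      exact (mem_tightParts.1 hA).prop.2.1
    simpa only [inside_eq_self hKV] using
      hK.card_inside_add_le_crossing hD.pairwiseDisjoint_tightParts hQV.ge hmeet
  have hcross : #(crossing ends Q K) ≤ m * #(crossing ends Q D) :=
    (card_le_card (h.crossing_tightParts_subset hD hDV fun e he =>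
      ⟨hK.ends_nonempty he, hKV e he⟩)).trans (Nat.le_mul_of_pos_left _ hm)
  nlinarith

lemma Rigid.trans [Nonempty α] (hI : Sparse ends m I) (hJ : Sparse ends m J)
    (hspan : Spans ends m I J) (h : Rigid ends m J B) : Rigid ends m I B := by
  classical
  obtain ⟨C, hC, hBC⟩ := h
  set V := C ∪ I.biUnion ends
  have hIV : ∀ e ∈ I, ends e ⊆ V := fun e he =>
    (subset_biUnion_of_mem ends he).trans subset_union_right
  set Q := {A ∈ tightParts ends m I V | (C ∩ A).Nonempty}
  have hdisj : (Q : Set (Finset α)).PairwiseDisjoint id :=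
    hI.pairwiseDisjoint_tightParts.subset (coe_subset.2 (filter_subset _ _))
  have hCQ : C ⊆ Q.biUnion id := fun x hx => by
    obtain ⟨A, hA, hxA⟩ := mem_biUnion.1 (hI.biUnion_tightParts.ge (mem_union_left _ hx))
    exact mem_biUnion.2 ⟨A, mem_filter.2 ⟨hA, x, mem_inter.2 ⟨hx, hxA⟩⟩, hxA⟩
  have hcross : crossing ends Q (inside ends J C) ⊆
      crossing ends Q (inside ends I (Q.biUnion id)) := by
    intro e he
    rw [mem_crossing, mem_inside] at he ⊢
    obtain ⟨⟨heJ, heC⟩, heQ⟩ := he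
    refine ⟨⟨(hspan e heJ).resolve_right fun hrigid => ?_, heC.trans hCQ⟩, heQ⟩
    obtain ⟨x, hx⟩ := hJ.ends_nonempty heJ
    obtain ⟨A, hA, heA⟩ := hrigid.exists_mem_tightParts hI hIV ⟨x, hx⟩
      (heC.trans subset_union_left)
    exact heQ A (mem_filter.2 ⟨hA, x, mem_inter.2 ⟨heC hx, heA hx⟩⟩) heA
  have hcardJ := hJ.card_inside_add_le_crossing hdisj hCQ fun A hA => (mem_filter.1 hA).2
  have hcardI := hI.card_inside_biUnion_eq_crossing hdisj fun A hA =>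
    (mem_tightParts.1 (mem_filter.1 hA).1).prop.2
  have hle := hI (hC.1.mono hCQ)
  have hCcard := hC.2
  have hcrossCard := card_le_card hcross
  exact ⟨Q.biUnion id, ⟨hC.1.mono hCQ, by lia⟩, hBC.trans hCQ⟩

end Sparse

section HoleColoring

variable {α β : Type*} [DecidableEq α] [DecidableEq β] {ends : β → Finset α} {m : ℕ}
  {T : Finset β} {B : Finset α} {i j : Fin m} {s t : (β → Fin m) × β} {e : β}

/-- The edges of colour `i` of `T` in the state `s = (c, f)`: a colouring `c` that ignores the edge
`f`, the hole. Moving the hole around is how a colouring is extended to one more edge. -/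
def colorClass (T : Finset β) (s : (β → Fin m) × β) (i : Fin m) : Finset β :=
  {e ∈ T.erase s.2 | s.1 e = i}

/-- The state `s` colours all of `T` but the hole, which lies in `T`, with `1`-sparse classes. -/
def IsHoleColoring (ends : β → Finset α) (T : Finset β) (s : (β → Fin m) × β) : Prop :=
  s.2 ∈ T ∧ ∀ i, Sparse ends 1 (colorClass T s i)

/-- The hole of `s` receives some colour `i`, and the hole of `t` is an edge of colour `i` in the
least tight set containing the ends of the hole of `s`. -/
def HoleMove (ends : β → Finset α) (T : Finset β) (s t : (β → Fin m) × β) : Prop :=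
  ∃ i Z, IsLeast {A | Tight ends 1 (colorClass T s i) A ∧ ends s.2 ⊆ A} Z ∧
    t.2 ∈ inside ends (colorClass T s i) Z ∧ t.1 = Function.update s.1 s.2 i

lemma mem_colorClass : e ∈ colorClass T s i ↔ (e ≠ s.2 ∧ e ∈ T) ∧ s.1 e = i := by
  rw [colorClass, mem_filter, mem_erase]

lemma colorClass_subset : colorClass T s i ⊆ T :=
  (filter_subset _ _).trans (erase_subset _ _)

lemma colorClass_update_self (hs : s.2 ∈ T) (ht : t.2 ∈ colorClass T s i)
    (hst : t.1 = Function.update s.1 s.2 i) :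
    colorClass T t i = insert s.2 ((colorClass T s i).erase t.2) := by
  have hne : s.2 ≠ t.2 := (mem_colorClass.1 ht).1.1.symm
  ext e
  rw [mem_insert, mem_erase, mem_colorClass, mem_colorClass, hst]
  rcases eq_or_ne e s.2 with rfl | he
  · simp only [ne_eq, hne, not_false_eq_true, hs, Function.update_self, and_self, true_or]
  · rw [Function.update_of_ne he]
    tauto

lemma colorClass_update_of_ne (ht : t.2 ∈ colorClass T s i)
    (hst : t.1 = Function.update s.1 s.2 i) (hij : j ≠ i) :
    colorClass T t j = colorClass T s j := by
  ext e
  rw [mem_colorClass, mem_colorClass, hst]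
  rcases eq_or_ne e s.2 with rfl | he
  · simp only [Function.update_self, hij.symm, and_false, ne_eq, not_true_eq_false, false_and]
  · rw [Function.update_of_ne he, and_congr_left_iff]
    rintro rfl
    have het : e ≠ t.2 := by
      rintro rfl
      exact hij (mem_colorClass.1 ht).2
    simp only [ne_eq, het, he]

lemma HoleMove.isHoleColoring (hst : HoleMove ends T s t) (hs : IsHoleColoring ends T s) :
    IsHoleColoring ends T t := by
  obtain ⟨i, Z, hZ, htZ, hupdate⟩ := hst
  have ht := inside_subset htZ
  refine ⟨colorClass_subset ht, fun j => ?_⟩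
  rcases eq_or_ne j i with rfl | hji
  · rw [colorClass_update_self hs.1 ht hupdate]
    exact (hs.2 j).insert_erase hZ htZ
  · rw [colorClass_update_of_ne ht hupdate hji]
    exact hs.2 j

lemma IsHoleColoring.of_reflTransGen (hs : IsHoleColoring ends T s)
    (hst : Relation.ReflTransGen (HoleMove ends T) s t) : IsHoleColoring ends T t := by
  induction hst with
  | refl => exact hs
  | tail _ hmove ih => exact hmove.isHoleColoring ih

lemma IsHoleColoring.exists_coloring_of_sparse_insert (hs : IsHoleColoring ends T s)
    (hi : Sparse ends 1 (insert s.2 (colorClass T s i))) :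
    ∃ c : β → Fin m, ∀ j, Sparse ends 1 {e ∈ T | c e = j} := by
  refine ⟨Function.update s.1 s.2 i, fun j => ?_⟩
  rcases eq_or_ne j i with rfl | hji
  · refine hi.mono fun e he => ?_
    rw [mem_filter] at he
    rcases eq_or_ne e s.2 with rfl | hes
    · exact mem_insert_self _ _
    · rw [Function.update_of_ne hes] at he
      exact mem_insert_of_mem (mem_colorClass.2 ⟨⟨hes, he.1⟩, he.2⟩)
  · refine (hs.2 j).mono fun e he => ?_
    rw [mem_filter] at he
    have hes : e ≠ s.2 := by
      rintro rfl
      exact hji (by rw [← he.2, Function.update_self])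
    rw [Function.update_of_ne hes] at he
    exact mem_colorClass.2 ⟨⟨hes, he.1⟩, he.2⟩

open Classical in
/-- The edges of `T` that moves starting from `s` turn into the hole. -/
noncomputable def reachableHoles (ends : β → Finset α) (T : Finset β) (s : (β → Fin m) × β) :
    Finset β :=
  {e ∈ T | ∃ c, Relation.ReflTransGen (HoleMove ends T) s (c, e)}

lemma mem_reachableHoles : e ∈ reachableHoles ends T s ↔
    e ∈ T ∧ ∃ c, Relation.ReflTransGen (HoleMove ends T) s (c, e) := by
  classical
  rw [reachableHoles, mem_filter]

lemma IsHoleColoring.rigid_inter_reachableHoles [Nonempty α] (hT : Sparse ends m T)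
    (hno : ∀ c : β → Fin m, ∃ j, ¬ Sparse ends 1 {e ∈ T | c e = j})
    (hs : IsHoleColoring ends T s) (hst : Relation.ReflTransGen (HoleMove ends T) s t)
    (i : Fin m) : Rigid ends 1 (colorClass T t i ∩ reachableHoles ends T s) (ends t.2) := by
  have ht := hs.of_reflTransGen hst
  have hrigid : Rigid ends 1 (colorClass T t i) (ends t.2) :=
    (ht.2 i).rigid_of_not_sparse_insert fun hins => by
      obtain ⟨c, hc⟩ := ht.exists_coloring_of_sparse_insert hins
      obtain ⟨j, hj⟩ := hno c
      exact hj (hc j)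
  obtain ⟨Z, hZ⟩ := hrigid.exists_isLeast (ht.2 i) (hT.ends_nonempty ht.1)
  have hinside : inside ends (colorClass T t i) Z ⊆
      inside ends (colorClass T t i ∩ reachableHoles ends T s) Z := fun e he => by
    have hmove : HoleMove ends T t (Function.update t.1 t.2 i, e) := ⟨i, Z, hZ, he, rfl⟩
    rw [mem_inside] at he ⊢
    exact ⟨mem_inter.2 ⟨he.1, mem_reachableHoles.2
      ⟨colorClass_subset he.1, _, hst.tail hmove⟩⟩, he.2⟩
  refine ⟨Z, ⟨hZ.1.1.1, ?_⟩, hZ.1.2⟩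
  rw [(inside_mono inter_subset_left subset_rfl).antisymm hinside]
  exact hZ.1.1.2

lemma IsHoleColoring.rigid_of_reflTransGen [Nonempty α] (hT : Sparse ends m T)
    (hno : ∀ c : β → Fin m, ∃ j, ¬ Sparse ends 1 {e ∈ T | c e = j})
    (hs : IsHoleColoring ends T s) (hst : Relation.ReflTransGen (HoleMove ends T) s t)
    (hB : Rigid ends 1 (colorClass T t i ∩ reachableHoles ends T s) B) :
    Rigid ends 1 (colorClass T s i ∩ reachableHoles ends T s) B := by
  induction hst with
  | refl => exact hB
  | @tail t u hst hmove ih =>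
    have ht := hs.of_reflTransGen hst
    have hu := hmove.isHoleColoring ht
    have hrigid := hs.rigid_inter_reachableHoles hT hno hst i
    obtain ⟨j, Z, hZ, huZ, hupdate⟩ := hmove
    refine ih (hB.trans ((ht.2 i).mono inter_subset_left) ((hu.2 i).mono inter_subset_left) ?_)
    intro e he
    rw [mem_inter] at he ⊢
    rcases eq_or_ne i j with rfl | hij
    · rw [colorClass_update_self ht.1 (inside_subset huZ) hupdate, mem_insert, mem_erase] at he
      obtain ⟨rfl | he', heE⟩ := he
      · exact Or.inr hrigid
      · exact Or.inl ⟨he'.2, heE⟩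
    · rw [colorClass_update_of_ne (inside_subset huZ) hupdate hij] at he
      exact Or.inl he

lemma IsHoleColoring.exists_coloring [Nonempty α] (hm : 0 < m) (hT : Sparse ends m T)
    (hs : IsHoleColoring ends T s) : ∃ c : β → Fin m, ∀ j, Sparse ends 1 {e ∈ T | c e = j} := by
  by_contra! hno
  set E := reachableHoles ends T s
  have hspans : ∀ i, Spans ends 1 (colorClass T s i ∩ E) E := fun i e he => by
    obtain ⟨-, c, hc⟩ := mem_reachableHoles.1 he
    exact Or.inr (hs.rigid_of_reflTransGen hT hno hc (hs.rigid_inter_reachableHoles hT hno hc i))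
  have hET : E ⊆ T := fun e he => (mem_reachableHoles.1 he).1
  have hE : Sparse ends (m * 1) E := by
    rw [mul_one]
    exact hT.mono hET
  have hcard : ∀ i, #E ≤ m * #(colorClass T s i ∩ E) := fun i =>
    (hspans i).card_le_mul hm ((hs.2 i).mono inter_subset_left) hE
  have hsE : s.2 ∈ E := mem_reachableHoles.2 ⟨hs.1, s.1, .refl⟩
  have hclasses : ∑ i, #(colorClass T s i ∩ E) = #(E.erase s.2) := by
    rw [card_eq_sum_card_fiberwise (f := s.1) (t := univ) fun _ _ => mem_univ _]
    refine sum_congr rfl fun i _ => congrArg card ?_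
    ext e
    simp only [mem_inter, mem_colorClass, mem_filter, mem_erase]
    exact ⟨fun h => ⟨⟨h.1.1.1, h.2⟩, h.1.2⟩, fun h => ⟨⟨⟨h.1.1, hET h.1.2⟩, h.2⟩, h.1.2⟩⟩
  have hsum : m * #E ≤ m * #(E.erase s.2) := by
    rw [← hclasses, mul_sum]
    simpa only [sum_const, card_univ, Fintype.card_fin, smul_eq_mul] using
      sum_le_sum fun i (_ : i ∈ univ) => hcard i
  exact (card_erase_lt_of_mem hsE).not_ge (Nat.le_of_mul_le_mul_left hsum hm)

end HoleColoring

section NashWilliams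

variable {α β : Type*} [DecidableEq α] {ends : β → Finset α} {m : ℕ} {T : Finset β}
  {A : Finset α} {P : Fin m → Finset β}

theorem Sparse.exists_coloring [Nonempty α] (hm : 0 < m) (hT : Sparse ends m T) :
    ∃ c : β → Fin m, ∀ i, Sparse ends 1 {e ∈ T | c e = i} := by
  classical
  induction T using Finset.induction_on with
  | empty =>
    exact ⟨fun _ => ⟨0, hm⟩, fun i => by simpa only [filter_empty] using sparse_empty ends 1⟩
  | insert f T hf ih =>
    obtain ⟨c, hc⟩ := ih (hT.mono (subset_insert f T))
    have hs : IsHoleColoring ends (insert f T) (c, f) :=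
      ⟨mem_insert_self f T, fun i => by simpa only [colorClass, erase_insert hf] using hc i⟩
    exact hs.exists_coloring hm hT

lemma Tight.colorClass_of_sparse {c : β → Fin m} (hA : Tight ends m T A)
    (hc : ∀ i, Sparse ends 1 {e ∈ T | c e = i}) (i : Fin m) :
    Tight ends 1 {e ∈ T | c e = i} A := by
  have hle : ∀ j ∈ univ, #(inside ends {e ∈ T | c e = j} A) ≤ #A - 1 := fun j _ => by
    have := hc j hA.1
    lia
  have hsum : ∑ j, #(inside ends {e ∈ T | c e = j} A) = ∑ j : Fin m, (#A - 1) := by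
    have hfiber := card_eq_sum_card_fiberwise (s := inside ends T A) (f := c) (t := univ)
      fun _ _ => mem_univ _
    simp only [inside, filter_filter, and_comm] at hfiber ⊢
    rw [← hfiber, sum_const, card_univ, Fintype.card_fin, smul_eq_mul, Nat.mul_sub, mul_one]
    have hcard := hA.2
    rw [inside] at hcard
    lia
  have heq := (sum_eq_sum_iff_of_le hle).1 hsum i (mem_univ i)
  have hpos := hA.1.card_pos
  exact ⟨hA.1, by lia⟩

lemma card_inside_biUnion [DecidableEq β] (hP : Pairwise fun i j => Disjoint (P i) (P j))
    (A : Finset α) : #(inside ends (univ.biUnion P) A) = ∑ i, #(inside ends (P i) A) := by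
  rw [inside, filter_biUnion, card_biUnion]
  · rfl
  · exact fun i _ j _ hij => (hP hij).mono (filter_subset _ _) (filter_subset _ _)

lemma Sparse.biUnion [DecidableEq β] (hdisj : Pairwise fun i j => Disjoint (P i) (P j))
    (hP : ∀ i, Sparse ends 1 (P i)) : Sparse ends m (univ.biUnion P) := by
  intro A hA
  have hsum := sum_le_sum fun i (_ : i ∈ univ) => hP i hA
  simpa only [card_inside_biUnion hdisj, sum_add_distrib, sum_const, card_univ,
    Fintype.card_fin, smul_eq_mul, one_mul, mul_one] using hsum

lemma Tight.biUnion [DecidableEq β] (hdisj : Pairwise fun i j => Disjoint (P i) (P j))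
    (hA : A.Nonempty) (hP : ∀ i, Tight ends 1 (P i) A) : Tight ends m (univ.biUnion P) A := by
  have hsum := sum_congr rfl fun i (_ : i ∈ univ) => (hP i).2
  refine ⟨hA, ?_⟩
  simpa only [card_inside_biUnion hdisj, sum_add_distrib, sum_const, card_univ,
    Fintype.card_fin, smul_eq_mul, one_mul, mul_one] using hsum

end NashWilliams

section Modification

variable {α β : Type*} {ends : β → Finset α} {m : ℕ} {I J K T T' T₁ T₂ : Finset β}
  {A B C D C₁ C₂ : Finset α} {e f : β} {z : α}

/-- `I` and `J` differ only in edges all of whose ends lie in `C`. -/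
def AgreeOutside (ends : β → Finset α) (C : Finset α) (I J : Finset β) : Prop :=
  ∀ ⦃e⦄, ¬ ends e ⊆ C → (e ∈ I ↔ e ∈ J)

lemma AgreeOutside.mono (h : AgreeOutside ends A I J) (hAB : A ⊆ B) : AgreeOutside ends B I J :=
  fun _ he => h fun heA => he (heA.trans hAB)

variable [DecidableEq α]

/-- The number of edges of `I` incident with `v`. -/
def degree (ends : β → Finset α) (I : Finset β) (v : α) : ℕ :=
  #{e ∈ I | v ∈ ends e}

lemma degree_mono (h : I ⊆ J) (z : α) : degree ends I z ≤ degree ends J z :=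
  card_le_card (filter_subset_filter _ h)

lemma AgreeOutside.card_inside_eq (h : AgreeOutside ends C I J) (hc : #I = #J) :
    #(inside ends I C) = #(inside ends J C) := by
  have hI := card_filter_add_card_filter_not (s := I) fun e => ends e ⊆ C
  have hJ := card_filter_add_card_filter_not (s := J) fun e => ends e ⊆ C
  have hout : {e ∈ I | ¬ ends e ⊆ C} = {e ∈ J | ¬ ends e ⊆ C} := by
    ext e
    simp only [mem_filter, and_congr_left_iff]
    exact fun he => h he
  rw [hout] at hI
  unfold inside
  lia

lemma AgreeOutside.degree_eq (h : AgreeOutside ends C I J) (hz : z ∉ C) :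
    degree ends I z = degree ends J z := by
  unfold degree
  congr 1
  ext e
  simp only [mem_filter, and_congr_left_iff]
  exact fun hze => h fun heC => hz (heC hze)

lemma AgreeOutside.tight_of_disjoint [Nonempty α] (h : AgreeOutside ends C I J)
    (hI : Sparse ends m I) (hJ : Sparse ends m J) (hCD : Disjoint D C) (hD : Tight ends m I D) :
    Tight ends m J D := by
  have houtside : ∀ {e}, (ends e).Nonempty → ends e ⊆ D → ¬ ends e ⊆ C := fun hne heD heC =>
    hne.ne_empty (subset_empty.1 (hCD heD heC))
  have hinside : inside ends J D = inside ends I D := by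
    ext e
    rw [mem_inside, mem_inside, and_congr_left_iff]
    exact fun heD => ⟨fun he => (h (houtside (hJ.ends_nonempty he) heD)).2 he,
      fun he => (h (houtside (hI.ends_nonempty he) heD)).1 he⟩
  exact ⟨hD.1, hinside ▸ hD.2⟩

section Splice

variable [DecidableEq β]

/-- `I` with its edges inside `C` replaced by those of `J`. -/
def splice (ends : β → Finset α) (C : Finset α) (I J : Finset β) : Finset β :=
  {e ∈ I | ¬ ends e ⊆ C} ∪ inside ends J C

lemma mem_splice : e ∈ splice ends C I J ↔ e ∈ I ∧ ¬ ends e ⊆ C ∨ e ∈ J ∧ ends e ⊆ C := by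
  rw [splice, mem_union, mem_filter, mem_inside]

lemma mem_splice_of_subset (he : ends e ⊆ C) : e ∈ splice ends C I J ↔ e ∈ J := by
  simp only [mem_splice, he, not_true_eq_false, and_false, and_true, false_or]

lemma agreeOutside_splice (ends : β → Finset α) (C : Finset α) (I J : Finset β) :
    AgreeOutside ends C I (splice ends C I J) := fun e he => by
  simp only [mem_splice, he, not_false_eq_true, and_true, and_false, or_false]

lemma card_splice (hI : Tight ends m I C) (hJ : Tight ends m J C) :
    #(splice ends C I J) = #I := by
  have hdisj : Disjoint {e ∈ I | ¬ ends e ⊆ C} (inside ends J C) :=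
    disjoint_left.2 fun e heI heJ => (mem_filter.1 heI).2 (mem_inside.1 heJ).2
  have hsplit := card_filter_add_card_filter_not (s := I) fun e => ends e ⊆ C
  have hcardI := hI.2
  have hcardJ := hJ.2
  rw [splice, card_union_of_disjoint hdisj]
  unfold inside at *
  lia

lemma Sparse.splice [Nonempty α] (hI : Sparse ends m I) (hC : Tight ends m I C)
    (hJ : Sparse ends m J) : Sparse ends m (splice ends C I J) := by
  intro A hA
  rcases (A ∩ C).eq_empty_or_nonempty with hempty | hne
  · have hsub : inside ends (EdgeSparsity.splice ends C I J) A ⊆ inside ends I A := by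
      intro e he
      rw [mem_inside, mem_splice] at he
      refine mem_inside.2 ⟨(he.1.resolve_right fun heJ => ?_).1, he.2⟩
      have heAC := subset_inter he.2 heJ.2
      rw [hempty, subset_empty] at heAC
      exact (hJ.ends_nonempty heJ.1).ne_empty heAC
    exact (Nat.add_le_add_right (card_le_card hsub) m).trans (hI hA)
  · set O : Finset β := {e ∈ inside ends I A | ¬ ends e ⊆ C}
    have hcover : inside ends (EdgeSparsity.splice ends C I J) A ⊆ O ∪ inside ends J (A ∩ C) := by
      intro e he
      rw [mem_inside, mem_splice] at he
      rw [mem_union, mem_filter, mem_inside, mem_inside, subset_inter_iff]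
      tauto
    have hdisj : Disjoint O (inside ends I C) :=
      disjoint_left.2 fun e heO heC => (mem_filter.1 heO).2 (mem_inside.1 heC).2
    have hunion : O ∪ inside ends I C ⊆ inside ends I (A ∪ C) :=
      union_subset ((filter_subset _ _).trans (inside_mono subset_rfl subset_union_left))
        (inside_mono subset_rfl subset_union_right)
    have hcardCover := (card_le_card hcover).trans (card_union_le _ _)
    have hcardUnion := card_le_card hunion
    rw [card_union_of_disjoint hdisj] at hcardUnion
    have hJle := hJ hne
    have hIle := hI (hA.mono subset_union_left : (A ∪ C).Nonempty)
    have hCcard := hC.2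
    have hcard : m * #(A ∪ C) + m * #(A ∩ C) = m * #A + m * #C := by
      rw [← mul_add, ← mul_add, card_union_add_card_inter]
    lia

end Splice

section ExchangeEdge

variable [DecidableEq β]

lemma Rigid.exists_insert_erase [Nonempty α] (hI : Sparse ends m I) (hJI : J ⊆ I)
    (he : (ends e).Nonempty) (hrigid : Rigid ends m I (ends e))
    (hnot : ¬ Rigid ends m J (ends e)) :
    ∃ f ∈ I, f ∉ J ∧ Sparse ends m (insert e (I.erase f)) ∧
      ∀ C, Tight ends m I C → ends e ⊆ C → ends f ⊆ C := by
  obtain ⟨Z, hZ⟩ := hrigid.exists_isLeast hI he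
  obtain ⟨f, hfZ, hfJ⟩ : ∃ f ∈ inside ends I Z, f ∉ J := by
    by_contra! hall
    have hinside : inside ends J Z = inside ends I Z :=
      (inside_mono hJI subset_rfl).antisymm fun g hg =>
        mem_inside.2 ⟨hall g hg, (mem_inside.1 hg).2⟩
    exact hnot ⟨Z, ⟨hZ.1.1.1, hinside ▸ hZ.1.1.2⟩, hZ.1.2⟩
  obtain ⟨hfI, hfends⟩ := mem_inside.1 hfZ
  exact ⟨f, hfI, hfJ, hI.insert_erase hZ hfZ, fun C hC heC => hfends.trans (hZ.2 ⟨hC, heC⟩)⟩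

lemma degree_insert_erase_le (e f : β) (I : Finset β) (z : α) :
    degree ends (insert e (I.erase f)) z ≤ degree ends I z + 1 := by
  refine le_trans (card_le_card ?_) (card_insert_le e _)
  intro g hg
  simp only [mem_filter, mem_insert, mem_erase] at hg ⊢
  tauto

lemma degree_insert_erase_of_notMem (hz : z ∉ ends e) :
    degree ends (insert e (I.erase f)) z = degree ends (I.erase f) z := by
  rw [degree, filter_insert, if_neg hz, degree]

lemma degree_erase_lt (hf : f ∈ I) (hz : z ∈ ends f) :
    degree ends (I.erase f) z < degree ends I z := by
  rw [degree, filter_erase]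
  exact card_erase_lt_of_mem (mem_filter.2 ⟨hf, hz⟩)

end ExchangeEdge

variable {E F : Finset β} {S S₀ S₁ V : Finset α}

/-- `T` is an `m`-sparse subset of `E` that contains `F` and for which `V` is tight. -/
structure IsBaseOver (ends : β → Finset α) (m : ℕ) (E F : Finset β) (V : Finset α)
    (T : Finset β) : Prop where
  subset : T ⊆ E
  superset : F ⊆ T
  sparse : Sparse ends m T
  tight : Tight ends m T V

lemma IsBaseOver.card_add (hE : ∀ e ∈ E, ends e ⊆ V) (hT : IsBaseOver ends m E F V T) :
    #T + m = m * #V := by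
  rw [← hT.tight.2, inside_eq_self fun e he => hE e (hT.subset he)]

lemma IsBaseOver.card_eq (hE : ∀ e ∈ E, ends e ⊆ V) (hT : IsBaseOver ends m E F V T)
    (hT' : IsBaseOver ends m E F V T') : #T = #T' := by
  have hcard := hT.card_add hE
  have hcard' := hT'.card_add hE
  lia

lemma IsBaseOver.of_card_eq (hE : ∀ e ∈ E, ends e ⊆ V) (hT : IsBaseOver ends m E F V T)
    (hKE : K ⊆ E) (hFK : F ⊆ K) (hK : Sparse ends m K) (hcard : #K = #T) :
    IsBaseOver ends m E F V K :=
  ⟨hKE, hFK, hK, hT.tight.1, by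
    rw [inside_eq_self fun e he => hE e (hKE he), hcard, hT.card_add hE]⟩

variable [DecidableEq β]

/-- The edges of `T` that belong to `F` or have no end in `S`. -/
def keep (ends : β → Finset α) (F : Finset β) (S : Finset α) (T : Finset β) : Finset β :=
  {e ∈ T | e ∈ F ∨ Disjoint (ends e) S}

lemma mem_keep : e ∈ keep ends F S T ↔ e ∈ T ∧ (e ∈ F ∨ Disjoint (ends e) S) := mem_filter

lemma keep_subset : keep ends F S T ⊆ T := filter_subset _ _

lemma keep_empty : keep ends F ∅ T = T :=
  filter_true_of_mem fun e _ => Or.inr (disjoint_empty_right (ends e))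

lemma keep_anti (h : S₀ ⊆ S₁) : keep ends F S₁ T ⊆ keep ends F S₀ T := fun e he => by
  rw [mem_keep] at he ⊢
  exact ⟨he.1, he.2.imp_right fun hdisj => hdisj.mono_right h⟩

lemma AgreeOutside.keep (h : AgreeOutside ends C T T') :
    AgreeOutside ends C (keep ends F S T) (keep ends F S T') := fun e he => by
  rw [mem_keep, mem_keep, h he]

/-- `T'` arises from `T` by changing edges that avoid `S` and lie inside a set `C` which is tight
already for the edges of `T` that belong to `F` or avoid `S`. -/
def Modifies (ends : β → Finset α) (m : ℕ) (F : Finset β) (S C : Finset α) (T T' : Finset β) :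
    Prop :=
  Tight ends m (keep ends F S T) C ∧ AgreeOutside ends (C \ S) T T'

lemma Modifies.agreeOutside (h : Modifies ends m F S C T T') : AgreeOutside ends C T T' :=
  h.2.mono sdiff_subset

lemma Modifies.symm (h : Modifies ends m F S C T T') (hT : Sparse ends m T) (hc : #T = #T') :
    Modifies ends m F S C T' T := by
  have hinsideT := h.1.inside_eq hT keep_subset
  have hinsideT' : inside ends (keep ends F S T') C = inside ends T' C := by
    refine (inside_mono keep_subset subset_rfl).antisymm fun e he => ?_
    rw [mem_inside] at he
    refine mem_inside.2 ⟨mem_keep.2 ⟨he.1, ?_⟩, he.2⟩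
    by_cases heCS : ends e ⊆ C \ S
    · exact Or.inr (disjoint_of_subset_left heCS sdiff_disjoint)
    · have heT : e ∈ inside ends T C := mem_inside.2 ⟨(h.2 heCS).2 he.1, he.2⟩
      rw [← hinsideT] at heT
      exact (mem_keep.1 (inside_subset heT)).2
  refine ⟨⟨h.1.1, ?_⟩, fun e he => (h.2 he).symm⟩
  rw [hinsideT', ← h.agreeOutside.card_inside_eq hc, ← hinsideT, h.1.2]

lemma Modifies.rigid_keep [Nonempty α] (h : Modifies ends m F S C T T') (hT : Sparse ends m T)
    (hT' : Sparse ends m T') (hB : Rigid ends m (keep ends F S T') B) :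
    Rigid ends m (keep ends F S T) B := by
  refine hB.trans (hT.mono keep_subset) (hT'.mono keep_subset) fun e he => ?_
  by_cases heC : ends e ⊆ C
  · exact Or.inr ⟨C, h.1, heC⟩
  · exact Or.inl ((h.agreeOutside.keep heC).2 he)

lemma Modifies.insert_erase (h : Modifies ends m F S C T T') (heC : ends e ⊆ C \ S)
    (hfC : ends f ⊆ C \ S) : Modifies ends m F S C T (insert e (T'.erase f)) := by
  refine ⟨h.1, fun g hg => ?_⟩
  have hge : g ≠ e := by
    rintro rfl
    exact hg heC
  have hgf : g ≠ f := by
    rintro rfl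
    exact hg hfC
  rw [mem_insert, or_iff_right hge, mem_erase, and_iff_right hgf]
  exact h.2 hg

lemma IsBaseOver.exists_modifies_of_disjoint [Nonempty α] (hE : ∀ e ∈ E, ends e ⊆ V)
    (hT : IsBaseOver ends m E F V T) (hT₁ : IsBaseOver ends m E F V T₁)
    (hT₂ : IsBaseOver ends m E F V T₂) (h₁ : Modifies ends m F S C₁ T T₁)
    (h₂ : Modifies ends m F S C₂ T T₂) (hC : Disjoint C₁ C₂) :
    ∃ Q, IsBaseOver ends m E F V Q ∧ Modifies ends m F S C₂ T₁ Q ∧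
      AgreeOutside ends (C₁ \ S) T₂ Q := by
  have hkeep₁ : Tight ends m (keep ends F S T₁) C₂ := h₁.agreeOutside.keep.tight_of_disjoint
    (hT.sparse.mono keep_subset) (hT₁.sparse.mono keep_subset) hC.symm h₂.1
  have htight₁ : Tight ends m T₁ C₂ := hkeep₁.mono hT₁.sparse keep_subset
  have htight₂ : Tight ends m T₂ C₂ :=
    (h₂.symm hT.sparse (hT.card_eq hE hT₂)).1.mono hT₂.sparse keep_subset
  refine ⟨splice ends C₂ T₁ T₂, hT₁.of_card_eq hE ?_ ?_ (hT₁.sparse.splice htight₁ hT₂.sparse)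
    (card_splice htight₁ htight₂), ⟨hkeep₁, fun e he => ?_⟩, fun e he => ?_⟩
  · exact union_subset ((filter_subset _ _).trans hT₁.subset) (inside_subset.trans hT₂.subset)
  · intro e he
    exact mem_splice.2 ((em' (ends e ⊆ C₂)).imp (fun heC => ⟨hT₁.superset he, heC⟩)
      fun heC => ⟨hT₂.superset he, heC⟩)
  · by_cases heC : ends e ⊆ C₂
    · have heC₁ : ¬ ends e ⊆ C₁ \ S := fun heC₁ => he <| by
        rw [subset_empty.1 (hC (heC₁.trans sdiff_subset) heC)]
        exact empty_subset _
      rw [mem_splice_of_subset heC, ← h₂.2 he, h₁.2 heC₁]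
    · exact agreeOutside_splice ends C₂ T₁ T₂ heC
  · by_cases heC : ends e ⊆ C₂
    · rw [mem_splice_of_subset heC]
    · rw [← agreeOutside_splice ends C₂ T₁ T₂ heC, ← h₁.2 he, h₂.agreeOutside heC]

end Modification

section Barrier

variable {α β : Type*} [DecidableEq α] {ends : β → Finset α} {m n : ℕ}
  {E F T T' T₁ T₂ : Finset β} {S S₀ S₁ V X : Finset α} {h : α → ℤ} {e : β} {x y v : α}

/-- The total amount by which the degrees of `T` exceed the bounds `h` on `X`. -/
def totalExcess (ends : β → Finset α) (X : Finset α) (h : α → ℤ) (T : Finset β) : ℕ :=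
  ∑ v ∈ X, (degree ends T v - h v).toNat

lemma totalExcess_lt (hw : x ∈ X) (hwT : h x < degree ends T x)
    (hlt : degree ends T' x < degree ends T x)
    (hle : ∀ z ∈ X, h z < degree ends T z → degree ends T' z ≤ degree ends T z)
    (hh : ∀ z ∈ X, degree ends T z ≤ h z → degree ends T' z ≤ h z) :
    totalExcess ends X h T' < totalExcess ends X h T := by
  refine sum_lt_sum (fun z hz => ?_) ⟨x, hw, by lia⟩
  rcases lt_or_ge (h z) (degree ends T z) with hz' | hz'
  · have hzle := hle z hz hz'
    lia
  · have hzle := hh z hz hz'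
    lia

variable [DecidableEq β]

/-- `T'` is a base that respects the degree bounds `h` on `X \ S` and arises from `T` by changing
edges that avoid `S`, within a tight set containing `v`. -/
def IsLocalModification (ends : β → Finset α) (m : ℕ) (E F : Finset β) (V X : Finset α)
    (h : α → ℤ) (S : Finset α) (v : α) (T T' : Finset β) : Prop :=
  IsBaseOver ends m E F V T' ∧ (∀ z ∈ X, z ∉ S → (degree ends T' z : ℤ) ≤ h z) ∧
    ∃ C, v ∈ C ∧ Modifies ends m F S C T T'

lemma IsLocalModification.exists_simultaneous [Nonempty α] (hE : ∀ e ∈ E, ends e ⊆ V)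
    (hT : IsBaseOver ends m E F V T) (hS : S₀ ⊆ S₁)
    (hrigid : Rigid ends m (keep ends F S₀ T) {x, y})
    (hnot : ¬ Rigid ends m (keep ends F S₁ T) {x, y})
    (h₁ : IsLocalModification ends m E F V X h S₁ x T T₁)
    (h₂ : IsLocalModification ends m E F V X h S₁ y T T₂) :
    ∃ Q C, IsBaseOver ends m E F V Q ∧ {x, y} ⊆ C ∧ Modifies ends m F S₀ C T Q ∧
      ¬ Rigid ends m (keep ends F S₁ Q) {x, y} ∧
      (∀ g, ¬ Disjoint (ends g) S₁ ∨ {x, y} ⊆ ends g → (g ∈ Q ↔ g ∈ T)) ∧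
      (∀ z ∈ X, z ∉ S₁ → (degree ends Q z : ℤ) ≤ h z) ∧
      degree ends Q x = degree ends T₁ x ∧ degree ends Q y = degree ends T₂ y := by
  obtain ⟨hT₁, hdeg₁, C₁, hxC₁, hmod₁⟩ := h₁
  obtain ⟨hT₂, hdeg₂, C₂, hyC₂, hmod₂⟩ := h₂
  have hsparse : ∀ S, Sparse ends m (keep ends F S T) := fun S => hT.sparse.mono keep_subset
  have hdisj : Disjoint C₁ C₂ :=
    hmod₁.1.disjoint_of_not_rigid (hsparse S₁) hmod₂.1 hxC₁ hyC₂ hnot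
  obtain ⟨Q, hQ, hmodQ, hagreeQ⟩ := hT.exists_modifies_of_disjoint hE hT₁ hT₂ hmod₁ hmod₂ hdisj
  have hchanged : ∀ g, ¬ ends g ⊆ C₁ \ S₁ → ¬ ends g ⊆ C₂ \ S₁ → (g ∈ Q ↔ g ∈ T) :=
    fun g hg₁ hg₂ => by rw [← hmodQ.2 hg₂, ← hmod₁.2 hg₁]
  have hdegC₁ : ∀ z ∈ C₁, degree ends T₁ z = degree ends Q z := fun z hz =>
    hmodQ.agreeOutside.degree_eq (disjoint_left.1 hdisj hz)
  have hdegC₂ : ∀ z ∉ C₁, degree ends T₂ z = degree ends Q z := fun z hz =>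
    (hagreeQ.mono sdiff_subset).degree_eq hz
  have hmono : keep ends F S₁ T ⊆ keep ends F S₀ T := keep_anti hS
  obtain ⟨C, hC, hC₁C, hC₂C⟩ := hrigid.exists_tight_superset (hsparse S₀)
    (hmod₁.1.mono (hsparse S₀) hmono) (hmod₂.1.mono (hsparse S₀) hmono) hxC₁ hyC₂
  refine ⟨Q, C, hQ, insert_subset (hC₁C hxC₁) (singleton_subset_iff.2 (hC₂C hyC₂)),
    ⟨hC, fun g hg => (hchanged g (fun hg₁ => ?_) fun hg₂ => ?_).symm⟩, fun hrigidQ => ?_,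
    fun g hg => hchanged g (fun hg₁ => ?_) fun hg₂ => ?_, fun z hz hzS => ?_,
    (hdegC₁ x hxC₁).symm, (hdegC₂ y (disjoint_right.1 hdisj hyC₂)).symm⟩
  · exact hg (hg₁.trans (sdiff_subset_sdiff hC₁C hS))
  · exact hg (hg₂.trans (sdiff_subset_sdiff hC₂C hS))
  · exact hnot (hmod₁.rigid_keep hT.sparse hT₁.sparse
      (hmodQ.rigid_keep hT₁.sparse hQ.sparse hrigidQ))
  · rcases hg with hg | hg
    · exact hg (disjoint_of_subset_left hg₁ sdiff_disjoint)
    · exact disjoint_right.1 hdisj hyC₂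
        (sdiff_subset (hg₁ (hg (mem_insert_of_mem (mem_singleton_self y)))))
  · rcases hg with hg | hg
    · exact hg (disjoint_of_subset_left hg₂ sdiff_disjoint)
    · exact disjoint_left.1 hdisj hxC₁ (sdiff_subset (hg₂ (hg (mem_insert_self x {y}))))
  · by_cases hzC : z ∈ C₁
    · exact hdegC₁ z hzC ▸ hdeg₁ z hz hzS
    · exact hdegC₂ z hzC ▸ hdeg₂ z hz hzS

lemma IsBaseOver.exists_insert_erase [Nonempty α] {C : Finset α} (hE : ∀ e ∈ E, ends e ⊆ V)
    (hT : IsBaseOver ends m E F V T) (heE : e ∈ E) (heT : e ∉ T) (he : (ends e).Nonempty)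
    (hC : Tight ends m (keep ends F S₀ T) C) (heC : ends e ⊆ C)
    (hnot : ¬ Rigid ends m (keep ends F S₁ T) (ends e)) :
    ∃ f ∈ T, ¬ Disjoint (ends f) S₁ ∧ ends f ⊆ C \ S₀ ∧
      IsBaseOver ends m E F V (insert e (T.erase f)) := by
  have hCT : Tight ends m T C := hC.mono hT.sparse keep_subset
  obtain ⟨f, hfT, hfkeep, hR, hleast⟩ := Rigid.exists_insert_erase hT.sparse
    keep_subset he ⟨C, hCT, heC⟩ hnot
  have hfC : ends f ⊆ C := hleast C hCT heC
  obtain ⟨hfF, hfS₁⟩ : f ∉ F ∧ ¬ Disjoint (ends f) S₁ := by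
    simpa only [mem_keep, hfT, true_and, not_or] using hfkeep
  have hfS₀ : Disjoint (ends f) S₀ := by
    have hf : f ∈ inside ends (keep ends F S₀ T) C :=
      hC.inside_eq hT.sparse keep_subset ▸ mem_inside.2 ⟨hfT, hfC⟩
    exact (mem_keep.1 (inside_subset hf)).2.resolve_left hfF
  refine ⟨f, hfT, hfS₁, subset_sdiff.2 ⟨hfC, hfS₀⟩, hT.of_card_eq hE ?_ (fun g hg => ?_) hR ?_⟩
  · exact insert_subset heE ((erase_subset f T).trans hT.subset)
  · exact mem_insert_of_mem (mem_erase.2 ⟨fun hgf => hfF (hgf ▸ hg), hT.superset hg⟩)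
  · rw [card_insert_of_notMem fun h => heT (mem_of_mem_erase h), card_erase_add_one hfT]

lemma IsLocalModification.exists_improvement [Nonempty α] (hE : ∀ e ∈ E, ends e ⊆ V)
    (hT : IsBaseOver ends m E F V T) (hS : S₀ ⊆ S₁) (heE : e ∈ E) (heT : e ∉ T)
    (he : ends e = {x, y}) (heS : Disjoint (ends e) S₁)
    (hrigid : Rigid ends m (keep ends F S₀ T) (ends e))
    (hnot : ¬ Rigid ends m (keep ends F S₁ T) (ends e))
    (h₁ : IsLocalModification ends m E F V X h S₁ x T T₁)
    (hx : x ∈ X → (degree ends T₁ x : ℤ) < h x)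
    (h₂ : IsLocalModification ends m E F V X h S₁ y T T₂)
    (hy : y ∈ X → (degree ends T₂ y : ℤ) < h y) :
    ∃ R C, ∃ w ∈ S₁, w ∉ S₀ ∧ w ∈ C ∧ IsBaseOver ends m E F V R ∧ Modifies ends m F S₀ C T R ∧
      degree ends R w < degree ends T w ∧ (∀ z ∈ S₁, degree ends R z ≤ degree ends T z) ∧
      ∀ z ∈ X, z ∉ S₁ → (degree ends R z : ℤ) ≤ h z := by
  rw [he] at hrigid hnot
  obtain ⟨Q, C, hQ, hxyC, hmod, hnotQ, hfixed, hdeg, hdegx, hdegy⟩ :=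
    h₁.exists_simultaneous hE hT hS hrigid hnot h₂
  have heQ : e ∉ Q := fun h => heT ((hfixed e (Or.inr he.ge)).1 h)
  rw [← he] at hxyC hnotQ
  obtain ⟨f, hfQ, hfS₁, hfC, hR⟩ := hQ.exists_insert_erase hE heE heQ (he ▸ insert_nonempty x {y})
    (hmod.symm hT.sparse (hT.card_eq hE hQ)).1 hxyC hnotQ
  obtain ⟨w, hwf, hwS₁⟩ := not_disjoint_iff.1 hfS₁
  have hnotMem : ∀ z ∈ S₁, z ∉ ends e := fun z hz hze => disjoint_left.1 heS hze hz
  have hdegS₁ : ∀ z ∈ S₁, degree ends Q z = degree ends T z := fun z hz => by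
    unfold degree
    congr 1
    ext g
    rw [mem_filter, mem_filter, and_congr_left_iff]
    exact fun hzg => hfixed g (Or.inl (not_disjoint_iff.2 ⟨z, hzg, hz⟩))
  refine ⟨insert e (Q.erase f), C, w, hwS₁, (mem_sdiff.1 (hfC hwf)).2, (mem_sdiff.1 (hfC hwf)).1,
    hR, hmod.insert_erase (subset_sdiff.2 ⟨hxyC, heS.mono_right hS⟩) hfC, ?_, fun z hz => ?_,
    fun z hzX hzS => ?_⟩
  · rw [degree_insert_erase_of_notMem (hnotMem w hwS₁), ← hdegS₁ w hwS₁]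
    exact degree_erase_lt hfQ hwf
  · rw [degree_insert_erase_of_notMem (hnotMem z hz), ← hdegS₁ z hz]
    exact degree_mono (erase_subset f Q) z
  · by_cases hze : z ∈ ends e
    · have hle := degree_insert_erase_le (ends := ends) e f Q z
      rw [he, mem_insert, mem_singleton] at hze
      rcases hze with rfl | rfl
      · lia
      · lia
    · rw [degree_insert_erase_of_notMem hze]
      exact (Int.ofNat_le.2 (degree_mono (erase_subset f Q) z)).trans (hdeg z hzX hzS)

/-- The increasing sequence of barrier sets: it starts with the vertices whose degree is too
large, and a vertex is added when no local modification makes its degree less than the bound. -/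
noncomputable def barrier (ends : β → Finset α) (m : ℕ) (E F : Finset β) (V X : Finset α)
    (h : α → ℤ) (T : Finset β) : ℕ → Finset α
  | 0 => {v ∈ X | h v < degree ends T v}
  | n + 1 => by
    classical
    exact barrier ends m E F V X h T n ∪ {v ∈ X | ∀ T',
      IsLocalModification ends m E F V X h (barrier ends m E F V X h T n) v T T' →
        h v ≤ degree ends T' v}

lemma mem_barrier_zero :
    v ∈ barrier ends m E F V X h T 0 ↔ v ∈ X ∧ h v < degree ends T v := by
  rw [barrier, mem_filter]

lemma mem_barrier_succ : v ∈ barrier ends m E F V X h T (n + 1) ↔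
    v ∈ barrier ends m E F V X h T n ∨ v ∈ X ∧ ∀ T',
      IsLocalModification ends m E F V X h (barrier ends m E F V X h T n) v T T' →
        h v ≤ degree ends T' v := by
  classical
  rw [barrier, mem_union, mem_filter]

lemma barrier_mono (ends : β → Finset α) (m : ℕ) (E F : Finset β) (V X : Finset α) (h : α → ℤ)
    (T : Finset β) : Monotone (barrier ends m E F V X h T) :=
  monotone_nat_of_le_succ fun _ _ hv => mem_barrier_succ.2 (Or.inl hv)

lemma barrier_subset (n : ℕ) : barrier ends m E F V X h T n ⊆ X := by
  induction n with
  | zero => exact filter_subset _ _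
  | succ n ih => exact fun v hv => (mem_barrier_succ.1 hv).elim (fun hv => ih hv) And.left

lemma degree_le_of_notMem_barrier (hv : v ∈ X) (hn : v ∉ barrier ends m E F V X h T n) :
    (degree ends T v : ℤ) ≤ h v := by
  by_contra! hlt
  exact hn (barrier_mono ends m E F V X h T (Nat.zero_le n) (mem_barrier_zero.2 ⟨hv, hlt⟩))

lemma IsBaseOver.isLocalModification_self (hT : IsBaseOver ends m E F V T) (n : ℕ) (v : α) :
    IsLocalModification ends m E F V X h (barrier ends m E F V X h T n) v T T :=
  ⟨hT, fun _ => degree_le_of_notMem_barrier, {v}, mem_singleton_self v,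
    (hT.sparse.mono keep_subset).tight_singleton v, fun _ _ => Iff.rfl⟩

lemma IsBaseOver.le_degree_of_mem_barrier (hT : IsBaseOver ends m E F V T)
    (hv : v ∈ barrier ends m E F V X h T n) : h v ≤ degree ends T v := by
  induction n with
  | zero => exact (mem_barrier_zero.1 hv).2.le
  | succ n ih =>
    rcases mem_barrier_succ.1 hv with hv | ⟨-, hv⟩
    · exact ih hv
    · exact hv T (hT.isLocalModification_self n v)

lemma IsBaseOver.exists_isLocalModification (hT : IsBaseOver ends m E F V T)
    (hv : v ∉ barrier ends m E F V X h T (n + 1)) :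
    ∃ T', IsLocalModification ends m E F V X h (barrier ends m E F V X h T n) v T T' ∧
      (v ∈ X → (degree ends T' v : ℤ) < h v) := by
  by_cases hvX : v ∈ X
  · rw [mem_barrier_succ, not_or] at hv
    have hnotall := hv.2
    push Not at hnotall
    obtain ⟨T', hmod, hlt⟩ := hnotall hvX
    exact ⟨T', hmod, fun _ => hlt⟩
  · exact ⟨T, hT.isLocalModification_self n v, fun hv => absurd hv hvX⟩

lemma IsBaseOver.exists_improvement_of_barrier [Nonempty α] (hE : ∀ e ∈ E, ends e ⊆ V)
    (hT : IsBaseOver ends m E F V T) (hS : S ⊆ barrier ends m E F V X h T n) (heE : e ∈ E)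
    (heT : e ∉ T) (he : ends e = {x, y})
    (hdisj : Disjoint (ends e) (barrier ends m E F V X h T (n + 1)))
    (hrigid : Rigid ends m (keep ends F S T) (ends e))
    (hnot : ¬ Rigid ends m (keep ends F (barrier ends m E F V X h T n) T) (ends e)) :
    ∃ R C, ∃ w ∈ barrier ends m E F V X h T n, w ∉ S ∧ w ∈ C ∧ IsBaseOver ends m E F V R ∧
      Modifies ends m F S C T R ∧ degree ends R w < degree ends T w ∧
      (∀ z ∈ barrier ends m E F V X h T n, degree ends R z ≤ degree ends T z) ∧
      ∀ z ∈ X, z ∉ barrier ends m E F V X h T n → (degree ends R z : ℤ) ≤ h z := by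
  have hxe : x ∈ ends e := he ▸ mem_insert_self x {y}
  have hye : y ∈ ends e := he ▸ mem_insert_of_mem (mem_singleton_self y)
  obtain ⟨T₁, h₁, hx⟩ := hT.exists_isLocalModification (disjoint_left.1 hdisj hxe)
  obtain ⟨T₂, h₂, hy⟩ := hT.exists_isLocalModification (disjoint_left.1 hdisj hye)
  exact h₁.exists_improvement hE hT hS heE heT he
    (hdisj.mono_right (barrier_mono ends m E F V X h T (Nat.le_succ n))) hrigid hnot hx h₂ hy

lemma IsBaseOver.rigid_keep_barrier [Nonempty α] (hE : ∀ e ∈ E, ends e ⊆ V)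
    (hT : IsBaseOver ends m E F V T)
    (hmin : ∀ T', IsBaseOver ends m E F V T' → totalExcess ends X h T ≤ totalExcess ends X h T')
    (heE : e ∈ E) (heT : e ∉ T) (he : ends e = {x, y}) (n : ℕ)
    (hdisj : Disjoint (ends e) (barrier ends m E F V X h T (n + 1))) :
    Rigid ends m (keep ends F (barrier ends m E F V X h T n) T) (ends e) := by
  by_contra hnot
  induction n with
  | zero =>
    have hrigid : Rigid ends m (keep ends F ∅ T) (ends e) := by
      rw [keep_empty]
      exact ⟨V, hT.tight, hE e heE⟩
    obtain ⟨R, -, w, hw, -, -, hR, -, hlt, hle, hh⟩ :=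
      hT.exists_improvement_of_barrier hE (empty_subset _) heE heT he hdisj hrigid hnot
    obtain ⟨hwX, hwT⟩ := mem_barrier_zero.1 hw
    refine (hmin R hR).not_gt (totalExcess_lt hwX hwT hlt
      (fun z hz hzT => hle z (mem_barrier_zero.2 ⟨hz, hzT⟩)) fun z hz hzT => hh z hz fun hz₀ => ?_)
    exact (mem_barrier_zero.1 hz₀).2.not_ge hzT
  | succ n ih =>
    have hmono : barrier ends m E F V X h T n ⊆ barrier ends m E F V X h T (n + 1) :=
      barrier_mono ends m E F V X h T (Nat.le_succ n)
    have hrigid : Rigid ends m (keep ends F (barrier ends m E F V X h T n) T) (ends e) :=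
      not_not.1 (ih (hdisj.mono_right (barrier_mono ends m E F V X h T (Nat.le_succ (n + 1)))))
    obtain ⟨R, C, w, hw, hwn, hwC, hR, hmod, hlt, hle, hh⟩ :=
      hT.exists_improvement_of_barrier hE hmono heE heT he hdisj hrigid hnot
    obtain ⟨hwX, hwall⟩ := (mem_barrier_succ.1 hw).resolve_left hwn
    have hwR : h w ≤ degree ends R w := hwall R ⟨hR, fun z hz hzn => ?_, C, hwC, hmod⟩
    · have hwT := degree_le_of_notMem_barrier hwX hwn
      lia
    · by_cases hzn' : z ∈ barrier ends m E F V X h T (n + 1)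
      · exact (Int.ofNat_le.2 (hle z hzn')).trans (degree_le_of_notMem_barrier hz hzn)
      · exact hh z hz hzn'

/-- The edges of `E` with no end in `S`. -/
def avoiding (ends : β → Finset α) (E : Finset β) (S : Finset α) : Finset β :=
  {e ∈ E | Disjoint (ends e) S}

/-- The obstruction to the degree bounds `h`: a set `S ⊆ X` on which the degrees of `T` are at
least the bounds and not all equal to them, such that the edges of `T` that belong to `F` or avoid
`S` span all edges avoiding `S`. -/
structure IsBarrier (ends : β → Finset α) (m : ℕ) (E F : Finset β) (X : Finset α) (h : α → ℤ)
    (T : Finset β) (S : Finset α) : Prop where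
  subset : S ⊆ X
  le_degree : ∀ v ∈ S, h v ≤ degree ends T v
  exists_lt_degree : ∃ v ∈ S, h v < degree ends T v
  spans : Spans ends m (keep ends F S T) (avoiding ends E S)

theorem IsBaseOver.exists_degree_le_or_isBarrier [Nonempty α] (hE : ∀ e ∈ E, ends e ⊆ V)
    (hE₂ : ∀ e ∈ E, ∃ x y, ends e = {x, y}) (X : Finset α) (h : α → ℤ)
    (hT : IsBaseOver ends m E F V T) :
    ∃ T, IsBaseOver ends m E F V T ∧
      ((∀ v ∈ X, degree ends T v ≤ h v) ∨ ∃ S, IsBarrier ends m E F X h T S) := by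
  classical
  obtain ⟨T, hT, hmin⟩ := exists_min_image {T ∈ E.powerset | IsBaseOver ends m E F V T}
    (totalExcess ends X h) ⟨T, mem_filter.2 ⟨mem_powerset.2 hT.subset, hT⟩⟩
  replace hT : IsBaseOver ends m E F V T := (mem_filter.1 hT).2
  refine ⟨T, hT, or_iff_not_imp_left.2 fun hlt => ?_⟩
  push Not at hlt
  obtain ⟨v, hvX, hv⟩ := hlt
  obtain ⟨-, ⟨n, rfl⟩, hn⟩ := (X.powerset.finite_toSet.subset (Set.range_subset_iff.2 fun n =>
    mem_powerset.2 (barrier_subset n))).exists_maximal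
      (Set.range_nonempty (barrier ends m E F V X h T))
  have hstable : barrier ends m E F V X h T (n + 1) ⊆ barrier ends m E F V X h T n :=
    hn ⟨n + 1, rfl⟩ (barrier_mono ends m E F V X h T (Nat.le_succ n))
  refine ⟨barrier ends m E F V X h T n, barrier_subset n, fun v => hT.le_degree_of_mem_barrier,
    ⟨v, barrier_mono ends m E F V X h T (Nat.zero_le n) (mem_barrier_zero.2 ⟨hvX, hv⟩), hv⟩,
    fun e he => ?_⟩
  obtain ⟨heE, heS⟩ := mem_filter.1 he
  by_cases heT : e ∈ T
  · exact Or.inl (mem_keep.2 ⟨heT, Or.inr heS⟩)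
  · obtain ⟨x, y, hxy⟩ := hE₂ e heE
    exact Or.inr (hT.rigid_keep_barrier hE
      (fun T' hT' => hmin T' (mem_filter.2 ⟨mem_powerset.2 hT'.subset, hT'⟩)) heE heT hxy n
      (heS.mono_right hstable))

end Barrier

section Counting

variable {α β : Type*} [DecidableEq α] {ends : β → Finset α} {m : ℕ}
  {E F F₀ I T : Finset β} {S V X A : Finset α} {x : α}

/-- The edges of `I` with at least one end in `S`. -/
def touching (ends : β → Finset α) (I : Finset β) (S : Finset α) : Finset β :=
  {e ∈ I | ¬ Disjoint (ends e) S}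

lemma sum_degree_le (hI : ∀ e ∈ I, #(ends e) ≤ 2) (S : Finset α) :
    ∑ v ∈ S, degree ends I v ≤ #(touching ends I S) + #(inside ends I S) := by
  have hdouble : ∑ v ∈ S, degree ends I v = ∑ e ∈ I, #(S ∩ ends e) := by
    simp only [← filter_mem_eq_inter]
    exact sum_card_bipartiteAbove_eq_sum_card_bipartiteBelow fun v e => v ∈ ends e
  rw [hdouble, touching, inside, card_filter, card_filter, ← sum_add_distrib]
  refine sum_le_sum fun e he => ?_
  by_cases hdisj : Disjoint (ends e) S
  · rw [inter_comm, disjoint_iff_inter_eq_empty.1 hdisj, card_empty]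
    exact Nat.zero_le _
  · by_cases hsub : ends e ⊆ S
    · rw [if_pos hdisj, if_pos hsub, inter_eq_right.2 hsub]
      exact hI e he
    · have hlt : #(S ∩ ends e) < #(ends e) :=
        card_lt_card (inter_subset_right.ssubset_of_ne fun h => hsub (inter_eq_right.1 h))
      have hle := hI e he
      rw [if_pos hdisj]
      lia

lemma Sparse.exists_extension [DecidableEq β] [Nonempty α] (hI : Sparse ends m I)
    (hF : ∀ e ∈ F, 1 < #(ends e)) (hIS : ∀ e ∈ I, Disjoint (ends e) S) :
    ∃ K ⊆ I ∪ F, Sparse ends m K ∧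
      #I + #(touching ends F S) ≤ #K + ∑ v ∈ S, (degree ends F v - m) := by
  induction S using Finset.induction_on generalizing I with
  | empty => exact ⟨I, subset_union_left, hI, by simp [touching]⟩
  | insert v S hv ih =>
    set N : Finset β := {e ∈ F | v ∈ ends e ∧ Disjoint (ends e) S}
    obtain ⟨N', hN'N, hN'card⟩ := exists_subset_card_eq (min_le_right m #N)
    have hN' : ∀ e ∈ N', e ∈ F ∧ v ∈ ends e ∧ Disjoint (ends e) S := fun e he =>
      mem_filter.1 (hN'N he)
    simp only [disjoint_insert_right] at hIS
    have hIN' : Sparse ends m (I ∪ N') := hI.union_star (fun e he => (hIS e he).1)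
      (fun e he => ⟨(hN' e he).2.1, hF e (hN' e he).1⟩) (hN'card ▸ min_le_left m #N)
    obtain ⟨K, hKsub, hK, hKcard⟩ := ih hIN' fun e he =>
      (mem_union.1 he).elim (fun heI => (hIS e heI).2) fun heN => (hN' e heN).2.2
    refine ⟨K, fun e he => ?_, hK, ?_⟩
    · rcases mem_union.1 (hKsub he) with heIN | heF
      · exact (mem_union.1 heIN).elim (mem_union_left F) fun heN =>
          mem_union_right I (hN' e heN).1
      · exact mem_union_right I heF
    · have htouch : #(touching ends F (insert v S)) ≤ #(touching ends F S) + #N := by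
        refine (card_le_card fun e he => ?_).trans (card_union_le _ _)
        simp only [touching, N, mem_union, mem_filter, disjoint_insert_right] at he ⊢
        tauto
      have hNdeg : #N ≤ degree ends F v :=
        card_le_card fun e he => mem_filter.2 ⟨(mem_filter.1 he).1, (mem_filter.1 he).2.1⟩
      have hunion : #(I ∪ N') = #I + #N' := card_union_of_disjoint <|
        disjoint_left.2 fun e heI heN => (hIS e heI).1 (hN' e heN).2.1
      rw [sum_insert hv]
      lia

lemma card_keep_add_card_touching [DecidableEq β] (hFT : F ⊆ T) (S : Finset α) :
    #(keep ends F S T) + #(touching ends T S) = #T + #(touching ends F S) := by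
  rw [← card_union_add_card_inter]
  congr 2
  · ext e
    simp only [mem_union, mem_keep, touching, mem_filter]
    tauto
  · ext e
    have heFT : e ∈ F → e ∈ T := fun he => hFT he
    simp only [mem_inter, mem_keep, touching, mem_filter]
    tauto

lemma IsBarrier.card_add_card_touching_le [DecidableEq β] [Nonempty α] {h : α → ℤ}
    (hS : IsBarrier ends m E F X h T S) (hT : IsBaseOver ends m E F V T) (hI : Sparse ends m I)
    (hIE : I ⊆ avoiding ends E S) :
    #I + #(touching ends T S) ≤ #T + ∑ v ∈ S, (degree ends F v - m) := by
  obtain ⟨K, hKsub, hK, hKcard⟩ := hI.exists_extension (F := F) (S := S)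
    (fun e he => hT.sparse.one_lt_card_ends (hT.superset he))
    fun e he => (mem_filter.1 (hIE he)).2
  have hspan : Spans ends m (keep ends F S T) K := fun e he => by
    rcases mem_union.1 (hKsub he) with heI | heF
    · exact hS.spans e (hIE heI)
    · exact Or.inl (mem_keep.2 ⟨hT.superset heF, Or.inl heF⟩)
  have hKkeep : #K ≤ 1 * #(keep ends F S T) :=
    hspan.card_le_mul one_pos (hT.sparse.mono keep_subset) (by rwa [one_mul])
  have hkeep := card_keep_add_card_touching (ends := ends) hT.superset S
  lia

lemma IsBarrier.sum_add_card_lt [DecidableEq β] [Nonempty α] {c : α → ℤ}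
    (hS : IsBarrier ends m E F X (fun v => c v + (degree ends F v - m : ℕ)) T S)
    (hT : IsBaseOver ends m E F V T) (hE : ∀ e ∈ E, #(ends e) ≤ 2) (hI : Sparse ends m I)
    (hIE : I ⊆ avoiding ends E S) :
    ∑ v ∈ S, c v + #I < #T + #(inside ends T S) := by
  have htouch := hS.card_add_card_touching_le hT hI hIE
  have hdegree := sum_degree_le (fun e he => hE e (hT.subset he)) S
  have hsum : ∑ v ∈ S, (c v + (degree ends F v - m : ℕ)) < ∑ v ∈ S, (degree ends T v : ℤ) :=
    sum_lt_sum hS.le_degree hS.exists_lt_degree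
  rw [sum_add_distrib] at hsum
  push_cast [← Nat.cast_sum] at hsum
  lia

lemma Tight.le_degree (hI : Sparse ends m I) (hA : Tight ends m I A) (hx : x ∈ A)
    (hcard : 1 < #A) : m ≤ degree ends I x := by
  classical
  have hsub : inside ends I A ⊆ inside ends I (A.erase x) ∪ {e ∈ I | x ∈ ends e} := by
    intro e he
    simp only [mem_union, mem_filter, mem_inside, subset_erase] at he ⊢
    tauto
  have hunion := (card_le_card hsub).trans (card_union_le _ _)
  have hne : (A.erase x).Nonempty := card_pos.1 (by rw [card_erase_of_mem hx]; lia)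
  have herase := hI hne
  have hAcard := hA.2
  rw [← card_erase_add_one hx, mul_add, mul_one] at hAcard
  unfold degree
  lia

lemma degree_union_add_degree_le [DecidableEq β] (hFT : F₀ ⊆ T) (hFF : F₀ ⊆ F) (v : α) :
    degree ends (T ∪ F) v + degree ends F₀ v ≤ degree ends T v + degree ends F v := by
  unfold degree
  rw [filter_union, ← card_union_add_card_inter {e ∈ T | v ∈ ends e}]
  exact Nat.add_le_add_left (card_le_card (subset_inter (filter_subset_filter _ hFT)
    (filter_subset_filter _ hFF))) _

lemma Spans.degree_union_add_le [DecidableEq β] (hspan : Spans ends m F₀ F)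
    (hF₀ : Sparse ends m F₀) (hF : ∀ e ∈ F, 1 < #(ends e)) (hFT : F₀ ⊆ T) (hFF : F₀ ⊆ F) (v : α) :
    degree ends (T ∪ F) v + (degree ends F₀ v - m) ≤ degree ends T v + (degree ends F v - m) := by
  have hunion := degree_union_add_degree_le (ends := ends) hFT hFF v
  by_cases hall : ∀ e ∈ F, v ∈ ends e → e ∈ F₀
  · have hle : degree ends F v ≤ degree ends F₀ v := card_le_card fun e he => by
      rw [mem_filter] at he ⊢
      exact ⟨hall e he.1 he.2, he.2⟩
    have hge := degree_mono (ends := ends) hFF v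
    lia
  · push Not at hall
    obtain ⟨e, he, hve, heF₀⟩ := hall
    obtain ⟨A, hA, heA⟩ := (hspan e he).resolve_left heF₀
    have hle : m ≤ degree ends F₀ v :=
      hA.le_degree hF₀ (heA hve) ((hF e he).trans_le (card_le_card heA))
    lia

end Counting

section Encoding

variable {α β : Type*} [DecidableEq α] {G H : Graph α β} {ends : β → Finset α} {m : ℕ}
  {D E F I : Finset β} {A V W : Finset α} {Q : Finset (Finset α)} {e : β} {x y : α}

/-- `V` and `E` are the vertex set and the edge set of `G`, and `ends` gives the ends of its edges.
Subgraphs share `ends`, whose values outside `E` are arbitrary. -/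
structure IsEncodedBy (G : Graph α β) (V : Finset α) (E : Finset β) (ends : β → Finset α) :
    Prop where
  vertexSet_eq : V(G) = V
  edgeSet_eq : E(G) = E
  ends_eq : ∀ ⦃e x y⦄, G.IsLink e x y → ends e = {x, y}

lemma exists_isEncodedBy (hV : V(G).Finite) (hE : E(G).Finite) :
    ∃ V E ends, IsEncodedBy G V E ends := by
  obtain ⟨V, hV⟩ := hV.exists_finset_coe
  obtain ⟨E, hE⟩ := hE.exists_finset_coe
  have hends : ∀ e, ∃ s : Finset α, ∀ ⦃x y⦄, G.IsLink e x y → s = {x, y} := by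
    intro e
    by_cases he : e ∈ E(G)
    · obtain ⟨x, y, hxy⟩ := G.exists_isLink_of_mem_edgeSet he
      refine ⟨{x, y}, fun x' y' h => ?_⟩
      obtain ⟨rfl, rfl⟩ | ⟨rfl, rfl⟩ := hxy.eq_and_eq_or_eq_and_eq h
      · rfl
      · exact pair_comm _ _
    · exact ⟨∅, fun x y h => absurd h.edge_mem he⟩
  choose ends hends using hends
  exact ⟨V, E, ends, hV.symm, hE.symm, hends⟩

namespace IsEncodedBy

lemma mem_vertexSet (hG : IsEncodedBy G V E ends) : x ∈ V(G) ↔ x ∈ V := by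
  rw [hG.vertexSet_eq, mem_coe]

lemma mem_edgeSet (hG : IsEncodedBy G V E ends) : e ∈ E(G) ↔ e ∈ E := by
  rw [hG.edgeSet_eq, mem_coe]

lemma exists_isLink (hG : IsEncodedBy G V E ends) (he : e ∈ E) :
    ∃ x y, G.IsLink e x y ∧ ends e = {x, y} := by
  obtain ⟨x, y, h⟩ := G.exists_isLink_of_mem_edgeSet (hG.mem_edgeSet.2 he)
  exact ⟨x, y, h, hG.ends_eq h⟩

lemma mem_of_isLink (hG : IsEncodedBy G V E ends) (h : G.IsLink e x y) : e ∈ E :=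
  hG.mem_edgeSet.1 h.edge_mem

lemma ends_subset_iff (hG : IsEncodedBy G V E ends) (h : G.IsLink e x y) :
    ends e ⊆ A ↔ x ∈ A ∧ y ∈ A := by
  rw [hG.ends_eq h, insert_subset_iff, singleton_subset_iff]

lemma ends_subset (hG : IsEncodedBy G V E ends) (he : e ∈ E) : ends e ⊆ V := by
  obtain ⟨x, y, h, -⟩ := hG.exists_isLink he
  exact (hG.ends_subset_iff h).2 ⟨hG.mem_vertexSet.1 h.left_mem, hG.mem_vertexSet.1 h.right_mem⟩

lemma ends_nonempty (hG : IsEncodedBy G V E ends) (he : e ∈ E) : (ends e).Nonempty := by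
  obtain ⟨x, y, -, hxy⟩ := hG.exists_isLink he
  exact hxy ▸ insert_nonempty x {y}

lemma card_ends_le_two (hG : IsEncodedBy G V E ends) (he : e ∈ E) : #(ends e) ≤ 2 := by
  obtain ⟨x, y, -, hxy⟩ := hG.exists_isLink he
  exact hxy ▸ card_le_two

lemma one_lt_card_ends [G.Loopless] (hG : IsEncodedBy G V E ends) (he : e ∈ E) :
    1 < #(ends e) := by
  obtain ⟨x, y, h, hxy⟩ := hG.exists_isLink he
  rw [hxy, card_pair h.ne]
  exact one_lt_two

lemma of_le (hG : IsEncodedBy G V E ends) (hH : H ≤ G) (hV : V(H) = W) (hE : E(H) = D) :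
    IsEncodedBy H W D ends :=
  ⟨hV, hE, fun _ _ _ h => hG.ends_eq (hH.isLink_mono h)⟩

lemma exists_of_isSpanningSubgraph (hG : IsEncodedBy G V E ends) (hH : H ≤s G) :
    ∃ D ⊆ E, IsEncodedBy H V D ends := by
  have hsub : E(H) ⊆ E := hG.edgeSet_eq ▸ hH.le.edgeSet_mono
  obtain ⟨D, hD⟩ := (E.finite_toSet.subset hsub).exists_finset_coe
  exact ⟨D, coe_subset.1 (hD ▸ hsub), hG.of_le hH.le (hH.vertexSet_eq.trans hG.vertexSet_eq)
    hD.symm⟩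

lemma restrict (hG : IsEncodedBy G V E ends) (hD : D ⊆ E) :
    IsEncodedBy (G.restrict (D : Set β)) V D ends := by
  refine hG.of_le Graph.restrict_le hG.vertexSet_eq ?_
  rw [Graph.edgeSet_restrict, hG.edgeSet_eq, Set.inter_eq_right.2 (coe_subset.2 hD)]

lemma edgeSet_induce (hG : IsEncodedBy G V E ends) (A : Finset α) :
    E(G.induce (A : Set α)) = inside ends E A := by
  ext e
  rw [Graph.edgeSet_induce, mem_coe, mem_inside]
  constructor
  · rintro ⟨x, y, h, hxy⟩
    exact ⟨hG.mem_of_isLink h, (hG.ends_subset_iff h).2 hxy⟩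
  · rintro ⟨he, heA⟩
    obtain ⟨x, y, h, -⟩ := hG.exists_isLink he
    exact ⟨x, y, h, (hG.ends_subset_iff h).1 heA⟩

lemma induce (hG : IsEncodedBy G V E ends) (hA : A ⊆ V) :
    IsEncodedBy (G.induce (A : Set α)) A (inside ends E A) ends :=
  hG.of_le (Graph.induce_le (hG.vertexSet_eq ▸ coe_subset.2 hA)) rfl (hG.edgeSet_induce A)

lemma deleteVerts (hG : IsEncodedBy G V E ends) (S : Finset α) :
    IsEncodedBy (G.deleteVerts (S : Set α)) (V \ S) (avoiding ends E S) ends := by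
  refine hG.of_le Graph.deleteVerts_le ?_ ?_
  · rw [Graph.vertexSet_deleteVerts, hG.vertexSet_eq, coe_sdiff]
  · ext e
    rw [Graph.edgeSet_deleteVerts, mem_coe, avoiding, mem_filter]
    constructor
    · rintro ⟨x, y, h, hxS, hyS⟩
      rw [hG.ends_eq h, disjoint_insert_left, disjoint_singleton_left]
      exact ⟨hG.mem_of_isLink h, hxS, hyS⟩
    · rintro ⟨he, heS⟩
      obtain ⟨x, y, h, hxy⟩ := hG.exists_isLink he
      rw [hxy, disjoint_insert_left, disjoint_singleton_left] at heS
      exact ⟨x, y, h, heS⟩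

lemma numEdgesInside_eq (hG : IsEncodedBy G V E ends) (A : Finset α) :
    G.numEdgesInside (A : Set α) = #(inside ends E A) := by
  rw [← Set.ncard_coe_finset, ← hG.edgeSet_induce, Graph.edgeSet_induce, Graph.numEdgesInside]
  congr 1
  ext e
  exact ⟨fun ⟨x, hx, y, hy, h⟩ => ⟨x, y, h, hx, hy⟩, fun ⟨x, y, h, hx, hy⟩ => ⟨x, hx, y, hy, h⟩⟩

lemma deg_eq (hG : IsEncodedBy G V E ends) (v : α) : G.deg v = degree ends E v := by
  rw [Graph.deg, degree, ← Set.ncard_coe_finset]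
  congr 1
  ext e
  rw [Graph.mem_incidenceSet, mem_coe, mem_filter]
  constructor
  · rintro ⟨w, h⟩
    exact ⟨hG.mem_of_isLink h, hG.ends_eq h ▸ mem_insert_self v {w}⟩
  · rintro ⟨he, hv⟩
    obtain ⟨x, y, h, hxy⟩ := hG.exists_isLink he
    rw [hxy, mem_insert, mem_singleton] at hv
    obtain rfl | rfl := hv
    · exact h.inc_left
    · exact h.inc_right

end IsEncodedBy

section TreeConnected

lemma Sparse.rigid_ends_of_card_le_two [Nonempty α] (hI : Sparse ends 1 I) (he : e ∈ I)
    (hcard : #(ends e) ≤ 2) : Rigid ends 1 I (ends e) := by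
  have hpos : 0 < #(inside ends I (ends e)) := card_pos.2 ⟨e, mem_inside.2 ⟨he, subset_rfl⟩⟩
  have hsparse := hI (hI.ends_nonempty he)
  exact ⟨ends e, ⟨hI.ends_nonempty he, by lia⟩, subset_rfl⟩

lemma Rigid.tight_of_ends_subset (hI : Sparse ends m I) (hV : ∀ e ∈ I, ends e ⊆ V)
    (hne : V.Nonempty) (h : Rigid ends m I V) : Tight ends m I V := by
  obtain ⟨A, hA, hVA⟩ := h
  have hAV : A ∩ V = V := inter_eq_right.2 hVA
  exact hAV ▸ hA.inter_of_ends_subset hI hV (hAV.symm ▸ hne)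

lemma Tight.exists_ends_not_subset_of_meets (hm : 0 < m) (hI : Sparse ends m I)
    (hA : Tight ends m I A) (hin : (A ∩ W).Nonempty) (hout : (A \ W).Nonempty) :
    ∃ e ∈ inside ends I A, ¬ ends e ⊆ W ∧ ¬ Disjoint (ends e) W := by
  classical
  by_contra! hclosed
  have hsub : inside ends I A ⊆ inside ends I (A ∩ W) ∪ inside ends I (A \ W) := by
    intro e he
    have hdisj := hclosed e he
    rw [mem_inside] at he
    rw [mem_union, mem_inside, mem_inside, subset_inter_iff, subset_sdiff]
    tauto
  have hle := (card_le_card hsub).trans (card_union_le _ _)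
  have hcard : m * #(A ∩ W) + m * #(A \ W) = m * #A := by
    rw [← mul_add, card_inter_add_card_sdiff]
  have hsparseIn := hI hin
  have hsparseOut := hI hout
  have htight := hA.2
  lia

namespace IsEncodedBy

lemma exists_sparse_tight_of_isConnected (hG : IsEncodedBy G V E ends) (hconn : G.IsConnected) :
    ∃ I ⊆ E, Sparse ends 1 I ∧ Tight ends 1 I V := by
  obtain ⟨⟨x, hx⟩, hreach⟩ := hconn
  have : Nonempty α := ⟨x⟩
  obtain ⟨I, -, hIE, hI, hspan⟩ := (sparse_empty ends 1).exists_spans (empty_subset E)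
  have hIV : ∀ e ∈ I, ends e ⊆ V := fun e he => hG.ends_subset (hIE he)
  have hrigid : ∀ e ∈ E, Rigid ends 1 I (ends e) := fun e he =>
    (hspan e he).elim (fun heI => hI.rigid_ends_of_card_le_two heI (hG.card_ends_le_two he)) id
  obtain ⟨A, hA, hxA⟩ := (hI.tight_singleton x).exists_mem_tightParts
    (singleton_subset_iff.2 (hG.mem_vertexSet.1 hx))
  have hVA : V ⊆ A := fun y hy => by
    induction hreach x hx y (hG.mem_vertexSet.2 hy) with
    | refl => exact singleton_subset_iff.1 hxA
    | @tail u w _ huw ih =>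
      obtain ⟨e, he⟩ := huw
      have heE : e ∈ E := hG.mem_of_isLink he
      obtain ⟨B, hB, heB⟩ := (hrigid e heE).exists_mem_tightParts hI hIV (hG.ends_nonempty heE)
        (hG.ends_subset heE)
      obtain ⟨huB, hwB⟩ := (hG.ends_subset_iff he).1 heB
      have huA : u ∈ A := ih (hG.mem_vertexSet.1 he.left_mem)
      rwa [hI.pairwiseDisjoint_tightParts.elim_finset hA hB u huA huB]
  obtain ⟨hAV, hAtight⟩ := (mem_tightParts.1 hA).prop
  exact ⟨I, hIE, hI, hAV.antisymm hVA ▸ hAtight⟩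

lemma isConnected_of_tight (hG : IsEncodedBy G V E ends) (hE : Sparse ends 1 E)
    (hV : Tight ends 1 E V) : G.IsConnected := by
  classical
  refine ⟨hV.1.imp fun x hx => hG.mem_vertexSet.2 hx, fun x hx y hy => ?_⟩
  rw [hG.mem_vertexSet] at hx hy
  set W : Finset α := {z ∈ V | Relation.ReflTransGen G.Adj x z} with hW
  by_contra hnot
  obtain ⟨e, he, hnsub, hmeet⟩ := hV.exists_ends_not_subset_of_meets one_pos hE (W := W)
    ⟨x, mem_inter.2 ⟨hx, mem_filter.2 ⟨hx, .refl⟩⟩⟩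
    ⟨y, mem_sdiff.2 ⟨hy, fun hyW => hnot (mem_filter.1 hyW).2⟩⟩
  rw [mem_inside] at he
  obtain ⟨u, w, huw, hends⟩ := hG.exists_isLink he.1
  obtain ⟨huV, hwV⟩ := (hG.ends_subset_iff huw).1 he.2
  have hiff : u ∈ W ↔ w ∈ W := by
    simp only [hW, mem_filter, huV, hwV, true_and]
    exact ⟨fun h => h.tail huw.adj, fun h => h.tail huw.adj.symm⟩
  rw [hG.ends_subset_iff huw] at hnsub
  rw [hends, disjoint_insert_left, disjoint_singleton_left] at hmeet
  tauto

lemma not_hasCycle_of_sparse (hG : IsEncodedBy G V E ends) (hE : Sparse ends 1 E) :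
    ¬ G.HasCycle := by
  rintro ⟨n, v, e, hv, he, hlink⟩
  have hle : #(univ : Finset (Fin (n + 1))) ≤ #(inside ends E (univ.image v)) := by
    refine card_le_card_of_injOn e (fun i _ => ?_) he.injOn
    exact mem_inside.2 ⟨hG.mem_of_isLink (hlink i), (hG.ends_subset_iff (hlink i)).2
      ⟨mem_image_of_mem v (mem_univ i), mem_image_of_mem v (mem_univ (i + 1))⟩⟩
  have hsparse := hE (univ_nonempty.image v)
  rw [card_image_of_injective _ hv] at hsparse
  lia

lemma isTree_of_sparse_of_tight (hG : IsEncodedBy G V E ends) (hE : Sparse ends 1 E)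
    (hV : Tight ends 1 E V) : G.IsTree :=
  ⟨hG.isConnected_of_tight hE hV, hG.not_hasCycle_of_sparse hE⟩

theorem isTreeConnected_iff (hm : 0 < m) (hG : IsEncodedBy G V E ends) :
    G.IsTreeConnected m ↔ ∃ I ⊆ E, Sparse ends m I ∧ Tight ends m I V := by
  classical
  constructor
  · rintro ⟨T, hT, hdisj⟩
    choose D hDE hD using fun i => hG.exists_of_isSpanningSubgraph (hT i).1
    choose P hPD hP hPV using fun i =>
      (hD i).exists_sparse_tight_of_isConnected (hT i).2.1
    have hPdisj : Pairwise fun i j => Disjoint (P i) (P j) := fun i j hij => by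
      have hdisjD := hdisj i j hij
      rw [(hD i).edgeSet_eq, (hD j).edgeSet_eq, disjoint_coe] at hdisjD
      exact hdisjD.mono (hPD i) (hPD j)
    exact ⟨univ.biUnion P, biUnion_subset.2 fun i _ => (hPD i).trans (hDE i),
      Sparse.biUnion hPdisj hP, Tight.biUnion hPdisj (hPV ⟨0, hm⟩).1 hPV⟩
  · rintro ⟨I, hIE, hI, hV⟩
    have : Nonempty α := ⟨hV.1.choose⟩
    obtain ⟨c, hc⟩ := hI.exists_coloring hm
    have hclass : ∀ i, IsEncodedBy (G.restrict (({e ∈ I | c e = i} : Finset β) : Set β)) V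
        {e ∈ I | c e = i} ends := fun i => hG.restrict ((filter_subset _ I).trans hIE)
    refine ⟨fun i => G.restrict (({e ∈ I | c e = i} : Finset β) : Set β), fun i =>
      ⟨⟨Graph.restrict_le, rfl⟩, (hclass i).isTree_of_sparse_of_tight (hc i)
        (hV.colorClass_of_sparse hc i)⟩, fun i j hij => ?_⟩
    rw [(hclass i).edgeSet_eq, (hclass j).edgeSet_eq, disjoint_coe, disjoint_filter]
    exact fun e _ hi hj => hij (hi.symm.trans hj)

lemma exists_isBaseOver (hm : 0 < m) (hG : IsEncodedBy G V E ends) (ht : G.IsTreeConnected m)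
    (hF : Sparse ends m F) (hFE : F ⊆ E) : ∃ T, IsBaseOver ends m E F V T := by
  obtain ⟨J, hJE, hJ, hV⟩ := (hG.isTreeConnected_iff hm).1 ht
  have : Nonempty α := ⟨hV.1.choose⟩
  obtain ⟨T, hFT, hTE, hT, hspan⟩ := hF.exists_spans hFE
  have hrigid : Rigid ends m T V :=
    Rigid.trans hT hJ (fun e he => hspan e (hJE he)) ⟨V, hV, subset_rfl⟩
  exact ⟨T, hTE, hFT, hT, hrigid.tight_of_ends_subset hT (fun e he => hG.ends_subset (hTE he)) hV.1⟩

lemma isTreeConnected_induce_of_tight (hm : 0 < m) (hG : IsEncodedBy G V E ends) (hIE : I ⊆ E)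
    (hI : Sparse ends m I) (hA : Tight ends m I A) (hAV : A ⊆ V) :
    (G.induce (A : Set α)).IsTreeConnected m := by
  refine ((hG.induce hAV).isTreeConnected_iff hm).2
    ⟨inside ends I A, inside_mono hIE subset_rfl, hI.mono inside_subset, hA.1, ?_⟩
  rw [inside_inside, inter_self, hA.2]

lemma rigid_of_isTreeConnected_induce (hm : 0 < m) (hG : IsEncodedBy G V E ends)
    (hI : Sparse ends m I) (hspan : Spans ends m I E) (hAV : A ⊆ V)
    (ht : (G.induce (A : Set α)).IsTreeConnected m) : A.Nonempty ∧ Rigid ends m I A := by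
  obtain ⟨J, hJE, hJ, hA⟩ := ((hG.induce hAV).isTreeConnected_iff hm).1 ht
  have : Nonempty α := ⟨hA.1.choose⟩
  exact ⟨hA.1, Rigid.trans hI hJ (fun e he => hspan e (inside_subset (hJE he)))
    ⟨A, hA, subset_rfl⟩⟩

lemma treeComponents_eq (hm : 0 < m) (hG : IsEncodedBy G V E ends) (hIE : I ⊆ E)
    (hI : Sparse ends m I) (hspan : Spans ends m I E) :
    G.treeComponents m = (↑) '' (tightParts ends m I V : Set (Finset α)) := by
  have hIV : ∀ e ∈ I, ends e ⊆ V := fun e he => hG.ends_subset (hIE he)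
  have hconn : ∀ A ∈ tightParts ends m I V,
      (A : Set α) ⊆ V(G) ∧ (G.induce (A : Set α)).IsTreeConnected m := fun A hA => by
    obtain ⟨hAV, hAtight⟩ := (mem_tightParts.1 hA).prop
    exact ⟨hG.vertexSet_eq ▸ coe_subset.2 hAV,
      hG.isTreeConnected_induce_of_tight hm hIE hI hAtight hAV⟩
  have hcover : ∀ B : Set α, B ⊆ V(G) → (G.induce B).IsTreeConnected m →
      ∃ A ∈ tightParts ends m I V, B ⊆ A := fun B hB ht => by
    rw [hG.vertexSet_eq] at hB
    obtain ⟨B, rfl⟩ := (V.finite_toSet.subset hB).exists_finset_coe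
    rw [coe_subset] at hB
    obtain ⟨hBne, hBrigid⟩ := hG.rigid_of_isTreeConnected_induce hm hI hspan hB ht
    obtain ⟨A, hA, hBA⟩ := hBrigid.exists_mem_tightParts hI hIV hBne hB
    exact ⟨A, hA, coe_subset.2 hBA⟩
  ext B
  simp only [Graph.treeComponents, Set.mem_ofPred_eq, Set.mem_image, mem_coe]
  constructor
  · intro hB
    obtain ⟨A, hA, hBA⟩ := hcover B hB.prop.1 hB.prop.2
    exact ⟨A, hA, (hB.eq_of_le (hconn A hA) hBA).symm⟩
  · rintro ⟨A, hA, rfl⟩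
    refine ⟨hconn A hA, fun B hB hAB => ?_⟩
    obtain ⟨C, hC, hBC⟩ := hcover B hB.1 hB.2
    rwa [(mem_tightParts.1 hA).eq_of_le (mem_tightParts.1 hC).prop (coe_subset.1 (hAB.trans hBC))]

lemma crossingEdges_eq (hG : IsEncodedBy G V E ends)
    (hdisj : (Q : Set (Finset α)).PairwiseDisjoint id) (hQ : Q.biUnion id = V) :
    G.crossingEdges ((↑) '' (Q : Set (Finset α))) = crossing ends Q E := by
  ext e
  simp only [Graph.crossingEdges, Set.mem_ofPred_eq, Set.mem_image, mem_coe,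
    exists_exists_and_eq_and, mem_crossing]
  constructor
  · rintro ⟨x, y, hl, A, hA, B, hB, hAB, hx, hy⟩
    refine ⟨hG.mem_of_isLink hl, fun C hC heC => hAB ?_⟩
    obtain ⟨hxC, hyC⟩ := (hG.ends_subset_iff hl).1 heC
    rw [hdisj.elim_finset hA hC x hx hxC, hdisj.elim_finset hB hC y hy hyC]
  · rintro ⟨he, hcross⟩
    obtain ⟨x, y, hl, -⟩ := hG.exists_isLink he
    obtain ⟨hxV, hyV⟩ := (hG.ends_subset_iff hl).1 (hG.ends_subset he)
    obtain ⟨A, hA, hxA⟩ := mem_biUnion.1 (hQ.ge hxV)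
    obtain ⟨B, hB, hyB⟩ := mem_biUnion.1 (hQ.ge hyV)
    refine ⟨x, y, hl, A, hA, B, hB, fun hAB => hcross A hA ?_, hxA, hyB⟩
    exact (hG.ends_subset_iff hl).2 ⟨hxA, coe_injective hAB ▸ hyB⟩

theorem mul_treeMeasure_eq [Nonempty α] (hm : 0 < m) (hG : IsEncodedBy G V E ends)
    (hIE : I ⊆ E) (hI : Sparse ends m I) (hspan : Spans ends m I E) :
    (m : ℝ) * G.treeMeasure m = m * #V - #I := by
  have hIV : ∀ e ∈ I, ends e ⊆ V := fun e he => hG.ends_subset (hIE he)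
  set Q := tightParts ends m I V
  have hcross : crossing ends Q E = crossing ends Q I :=
    (hspan.crossing_tightParts_subset hI hIV fun e he =>
      ⟨hG.ends_nonempty he, hG.ends_subset he⟩).antisymm (filter_subset_filter _ hIE)
  have hcard : (#I : ℝ) + m * #Q = m * #V + #(crossing ends Q I) := by
    exact_mod_cast hI.card_add_tightParts hIV
  rw [Graph.treeMeasure, hG.treeComponents_eq hm hIE hI hspan,
    hG.crossingEdges_eq hI.pairwiseDisjoint_tightParts hI.biUnion_tightParts, hcross,
    Set.ncard_image_of_injective _ coe_injective, Set.ncard_coe_finset, Set.ncard_coe_finset]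
  field_simp
  linarith

end IsEncodedBy

end TreeConnected

end Encoding

section TreeMeasure

variable {α β : Type*} [DecidableEq α] {G H : Graph α β} {ends : β → Finset α}
  {m : ℕ} {D E F T : Finset β} {S V X : Finset α}

lemma IsBarrier.sum_add_le_mul_treeMeasure [DecidableEq β] (hm : 0 < m)
    (hG : IsEncodedBy G V E ends) (hT : IsBaseOver ends m E F V T) (hSV : S ⊆ V) {c : α → ℤ}
    (hS : IsBarrier ends m E F X (fun v => c v + (degree ends F v - m : ℕ)) T S) :
    ∑ v ∈ S, (c v : ℝ) + m + 1 ≤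
      m * (G.deleteVerts (S : Set α)).treeMeasure m + m * #S + #(inside ends T S) := by
  have : Nonempty α := ⟨hT.tight.1.choose⟩
  obtain ⟨I, -, hIE, hI, hspan⟩ :=
    (sparse_empty ends m).exists_spans (empty_subset (avoiding ends E S))
  have hrank : ∑ v ∈ S, (c v : ℝ) + #I + 1 ≤ #T + #(inside ends T S) := by
    exact_mod_cast hS.sum_add_card_lt hT (fun e he => hG.card_ends_le_two he) hI hIE
  have hcard : (#T : ℝ) + m = m * #V := by
    exact_mod_cast hT.card_add fun e he => hG.ends_subset he
  rw [(hG.deleteVerts S).mul_treeMeasure_eq hm hIE hI hspan, cast_card_sdiff hSV]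
  linarith

theorem IsBarrier.le_treeMeasure [DecidableEq β] (hm : 0 < m) (hG : IsEncodedBy G V E ends)
    (hT : IsBaseOver ends m E F V T) (hSV : S ⊆ V) {lam : ℝ}
    (hlam : lam ∈ Set.Icc (0 : ℝ) (1 / (m : ℝ))) {η : α → ℝ}
    (hS : IsBarrier ends m E F X
      (fun v => ⌈(m : ℝ) * η v - (m : ℝ) ^ 2 * lam⌉ + (degree ends F v - m : ℕ)) T S) :
    1 / (m : ℝ) + ∑ v ∈ S, (η v - 2) + 2 - lam * (G.numEdgesInside (S : Set α) + m) ≤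
      (G.deleteVerts (S : Set α)).treeMeasure m := by
  have hm₀ : (0 : ℝ) < m := by exact_mod_cast hm
  have hmlam : m * lam ≤ 1 := (le_div_iff₀' hm₀).1 hlam.2
  have hceil : m * ∑ v ∈ S, η v - #S * (m ^ 2 * lam) ≤
      ∑ v ∈ S, (⌈(m : ℝ) * η v - (m : ℝ) ^ 2 * lam⌉ : ℝ) := by
    rw [mul_sum, ← nsmul_eq_mul, ← sum_const, ← sum_sub_distrib]
    exact sum_le_sum fun v _ => Int.le_ceil _
  have hmeasure := hS.sum_add_le_mul_treeMeasure hm hG hT hSV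
  have hsparse : (#(inside ends T S) : ℝ) + m ≤ m * #S := by
    obtain ⟨v, hv, -⟩ := hS.exists_lt_degree
    exact_mod_cast hT.sparse ⟨v, hv⟩
  have hinside : (#(inside ends T S) : ℝ) ≤ G.numEdgesInside (S : Set α) := by
    rw [hG.numEdgesInside_eq]
    exact_mod_cast card_le_card (inside_mono (ends := ends) hT.subset (subset_refl S))
  have hslack : 0 ≤ (1 - m * lam) * (m * #S - m - #(inside ends T S)) :=
    mul_nonneg (by linarith) (by linarith)
  have hextra : 0 ≤ m * lam * (G.numEdgesInside (S : Set α) - #(inside ends T S)) :=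
    mul_nonneg (mul_nonneg hm₀.le hlam.1) (by linarith)
  refine le_of_mul_le_mul_left ?_ hm₀
  calc m * (1 / (m : ℝ) + ∑ v ∈ S, (η v - 2) + 2 - lam * (G.numEdgesInside (S : Set α) + m))
      = 1 + m * ∑ v ∈ S, η v - 2 * m * #S + 2 * m
          - m * lam * G.numEdgesInside (S : Set α) - m ^ 2 * lam := by
        rw [sum_sub_distrib, sum_const, nsmul_eq_mul]
        field_simp
        ring
    _ ≤ m * (G.deleteVerts (S : Set α)).treeMeasure m := by linarith

lemma IsBaseOver.exists_isTreeConnected [G.Loopless] (hm : 0 < m) (hG : IsEncodedBy G V E ends)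
    (hH : H ≤s G) (hD : IsEncodedBy H V D ends) (hF : Sparse ends m F) (hFD : F ⊆ D)
    (hspan : Spans ends m F D) (hT : IsBaseOver ends m E F V T) :
    ∃ K : Graph α β, K ≤s G ∧ H ≤s K ∧ K.IsTreeConnected m ∧
      ∀ v, K.deg v + (degree ends F v - m) ≤ degree ends T v + (H.deg v - m) := by
  classical
  have hDE : D ⊆ E := coe_subset.1 (hD.edgeSet_eq ▸ hG.edgeSet_eq ▸ hH.le.edgeSet_mono)
  have hK := hG.restrict (union_subset hT.subset hDE)
  refine ⟨G.restrict ((T ∪ D : Finset β) : Set β), ⟨Graph.restrict_le, rfl⟩,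
    ⟨⟨hH.vertexSet_eq.le, fun e x y h => ⟨?_, hH.le.isLink_mono h⟩⟩, hH.vertexSet_eq⟩,
    (hK.isTreeConnected_iff hm).2 ⟨T, subset_union_left, hT.sparse, hT.tight⟩, fun v => ?_⟩
  · exact mem_coe.2 (mem_union_right T (hD.mem_of_isLink h))
  · rw [hK.deg_eq, hD.deg_eq]
    exact hspan.degree_union_add_le hF (fun e he => hG.one_lt_card_ends (hDE he)) hT.superset
      hFD v

end TreeMeasure

end EdgeSparsity

open EdgeSparsity in
theorem mainTheorem9 {α β : Type*} (m : ℕ) (hm : 0 < m)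
    (G : Graph α β) [G.Loopless] (hVfin : V(G).Finite) (hEfin : E(G).Finite)
    (hG : G.IsTreeConnected m)
    (X : Set α) (hX : X ⊆ V(G))
    (F : Graph α β) (hF : F ≤s G)
    (lam : ℝ) (hlam : lam ∈ Set.Icc (0 : ℝ) (1 / (m : ℝ)))
    (η : α → ℝ) (hη : ∀ v ∈ X, (m : ℝ) * lam + ((m : ℝ) - 1) / (m : ℝ) < η v)
    (hΩ : ∀ S : Finset α, (S : Set α) ⊆ X →
      (G.deleteVerts (S : Set α)).treeMeasure m
        < 1 / (m : ℝ) + ∑ v ∈ S, (η v - 2) + 2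
          - lam * ((G.numEdgesInside (S : Set α) : ℝ) + (m : ℝ))) :
    ∃ H : Graph α β, H ≤s G ∧ F ≤s H ∧ H.IsTreeConnected m ∧
      ∀ v ∈ X, (H.deg v : ℤ)
        ≤ ⌈(m : ℝ) * η v - (m : ℝ) ^ 2 * lam⌉ + max 0 ((F.deg v : ℤ) - (m : ℤ)) := by
  classical
  obtain ⟨V, E, ends, hE⟩ := exists_isEncodedBy hVfin hEfin
  obtain ⟨D, hDE, hD⟩ := hE.exists_of_isSpanningSubgraph hF
  obtain ⟨X, rfl⟩ := (hVfin.subset hX).exists_finset_coe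
  obtain ⟨F₀, -, hF₀D, hF₀, hspan⟩ := (sparse_empty ends m).exists_spans (Finset.empty_subset D)
  obtain ⟨T₀, hT₀⟩ := hE.exists_isBaseOver hm hG hF₀ (hF₀D.trans hDE)
  have : Nonempty α := ⟨hT₀.tight.1.choose⟩
  obtain ⟨T, hT, hdeg | ⟨S, hS⟩⟩ := hT₀.exists_degree_le_or_isBarrier
    (fun e he => hE.ends_subset he) (fun e he => (hE.exists_isLink he).imp fun x ⟨y, h⟩ => ⟨y, h.2⟩)
    X fun v => ⌈(m : ℝ) * η v - (m : ℝ) ^ 2 * lam⌉ + (degree ends F₀ v - m : ℕ)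
  · obtain ⟨H, hHG, hFH, hH, hbound⟩ := hT.exists_isTreeConnected hm hE hF hD hF₀ hF₀D hspan
    refine ⟨H, hHG, hFH, hH, fun v hv => ?_⟩
    have hT_le := hdeg v hv
    have hH_le := hbound v
    lia
  · have hSV : S ⊆ V := fun v hv => hE.mem_vertexSet.1 (hX (hS.subset hv))
    exact absurd (hΩ S (Finset.coe_subset.2 hS.subset))
      (hS.le_treeMeasure hm hE hT hSV hlam).not_gt
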